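/- Let $\Omega=(0,1)$, let $\|\cdot\|$ and $\langle\cdot,\cdot\rangle$ be the norm and inner product of $L_2(\Omega)$, and for $0<\varepsilon\le 1$ and $f\in L_2(\Omega)$ let $u$ be the solution of $$\varepsilon^4u^{(4)}+4u=f\ \text{ in }\Omega,\qquad u(\xi)=u'(\xi)=0,\ \xi\in\{0,1\}.$$ Let $p\ge 3$ be an integer, and let $\lambda\ge 3$ and $\sigma\ge p+1$ be real. Assume that, with $K=p+3$ and a constant $M$, $u=u_{\mathrm{bl},0}+u_{\mathrm{reg}}+u_{\mathrm{bl},1}$ on $[0,1]$ with functions in $C^K[0,1]$ such that for all $x\in[0,1]$ and $\kappa=0,\dots,K$ $$|u_{\mathrm{reg}}^{(\kappa)}(x)|\le M,\quad |u_{\mathrm{bl},0}^{(\kappa)}(x)|\le M\varepsilon^{-\kappa}e^{-x/\varepsilon},\quad |u_{\mathrm{bl},1}^{(\kappa)}(x)|\le M\varepsilon^{-\kappa}e^{-(1-x)/\varepsilon},$$ and $\varepsilon^4u_{\mathrm{reg}}^{(4)}+4u_{\mathrm{reg}}=f$, $\varepsilon^4u_{\mathrm{bl},i}^{(4)}+4u_{\mathrm{bl},i}=0$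 ($i=0,1$) in $\Omega$. Let $N$ be a positive multiple of $4$ and $\tau=\min\{1/4,\sigma\varepsilon\ln N\}$. The Shishkin mesh divides $[0,\tau]$ and $[1-\tau,1]$ uniformly into $N/4$ intervals each and $[\tau,1-\tau]$ uniformly into $N/2$ intervals. Let $V=H^2_0(\Omega)\times H^2(\Omega)$, let $V_h$ be the set of pairs in $V$ of $C^1[0,1]$ functions that are polynomials of degree at most $p$ on each mesh interval, and let $(u_h,v_h)\in V_h$ be the finite element solution, i.e. for all $(u_*,v_*)\in V_h$ $$\lambda\langle v_h-\varepsilon^{3/2}u_h'',\,v_*-\varepsilon^{3/2}u_*''\rangle+\langle\varepsilon^{5/2}v_h''+4u_h,\,\varepsilon^{3/2}v_*''+4u_*\rangle=\langle f,\,\varepsilon^{3/2}v_*''+4u_*\rangle .$$ Then there is a constant $C>0$, depending only on $p,\lambda,\sigma,M$ (so not on $\varepsilon$ or $N$), with $$\|u-u_h\|+\|\varepsilon^{3/2}u''-v_h\|\le C\left\{(\ln N)^{p+1}+|\lambda-4|\min\{\varepsilon^{3/2}N^2,\varepsilon^{-1/2}\}\right\}N^{-(p+1)} .$$ If moreover $\lambda=4$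 or $\varepsilon^{3/2}\le N^{-2}$, then $$\|u-u_h\|+\|\varepsilon^{3/2}u''-v_h\|\le C\,(N^{-1}\ln N)^{p+1}.$$ -/

import Mathlib

open MeasureTheory Set

noncomputable section

namespace ShellFEM

/-- Lebesgue measure on the domain `Ω = (0,1)`. -/
abbrev volΩ : Measure ℝ := volume.restrict (Ioo (0 : ℝ) 1)

/-- The `k`-th derivative of a function on the closed unit interval (one-sided at the end
points). Values of the function outside `[0,1]` play no role. -/
def D (k : ℕ) (w : ℝ → ℝ) : ℝ → ℝ := iteratedDerivWithin k w (Icc 0 1)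

/-- The inner product of `L₂(Ω)`. -/
def ip (w z : ℝ → ℝ) : ℝ := ∫ x in (0 : ℝ)..1, w x * z x

/-- The norm of `L₂(Ω)`. -/
def l2norm (w : ℝ → ℝ) : ℝ := Real.sqrt (ip w w)

/-- Membership in the Sobolev space `H^k(Ω)`. In one dimension `H^{k+1}(0,1)` consists of the
functions in `C^k[0,1]` whose `k`-th derivative is absolutely continuous with a square integrable
derivative; the elements are identified with these representatives, and for them
`D (k+1) w` is, almost everywhere, the weak derivative of order `k+1`. -/
def MemH : ℕ → (ℝ → ℝ) → Prop
  | 0, w => MemLp w 2 volΩ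
  | k + 1, w =>
      ContDiffOn ℝ k w (Icc 0 1) ∧
      AbsolutelyContinuousOnInterval (D k w) 0 1 ∧
      MemLp (D (k + 1) w) 2 volΩ

/-- The boundary conditions `w(ξ) = w'(ξ) = 0` for `ξ ∈ {0,1}`. -/
def Clamped (w : ℝ → ℝ) : Prop :=
  ∀ ξ ∈ ({0, 1} : Set ℝ), w ξ = 0 ∧ D 1 w ξ = 0

/-- `H^2_0(Ω)`: the functions of `H^2(Ω)` that satisfy the homogeneous boundary conditions. -/
def MemH20 (w : ℝ → ℝ) : Prop := MemH 2 w ∧ Clamped w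

/-- `u` solves `ε⁴ u⁗ + 4 u = f` in `Ω` (almost everywhere, as `f` is an `L₂` function)
with clamped boundary conditions. -/
def IsSolution (ε : ℝ) (f u : ℝ → ℝ) : Prop :=
  MemH 4 u ∧ (∀ᵐ x ∂volΩ, ε ^ 4 * D 4 u x + 4 * u x = f x) ∧ Clamped u

/-- The solution `u` has a decomposition `u = u₀ + u_reg + u₁` on `[0,1]` into a regular component
and two boundary layer components, with derivative bounds up to order `K` and with the constant
`M` in all the bounds. -/
def HasDecomposition (K : ℕ) (M ε : ℝ) (f u : ℝ → ℝ) : Prop :=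
  ∃ u₀ ureg u₁ : ℝ → ℝ,
    ContDiffOn ℝ K u₀ (Icc 0 1) ∧ ContDiffOn ℝ K ureg (Icc 0 1) ∧ ContDiffOn ℝ K u₁ (Icc 0 1) ∧
    (∀ x ∈ Icc (0 : ℝ) 1, u x = u₀ x + ureg x + u₁ x) ∧
    (∀ κ ≤ K, ∀ x ∈ Icc (0 : ℝ) 1, |D κ ureg x| ≤ M) ∧
    (∀ κ ≤ K, ∀ x ∈ Icc (0 : ℝ) 1, |D κ u₀ x| ≤ M * ((ε ^ κ)⁻¹ * Real.exp (-x / ε))) ∧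
    (∀ κ ≤ K, ∀ x ∈ Icc (0 : ℝ) 1, |D κ u₁ x| ≤ M * ((ε ^ κ)⁻¹ * Real.exp (-(1 - x) / ε))) ∧
    (∀ᵐ x ∂volΩ, ε ^ 4 * D 4 ureg x + 4 * ureg x = f x) ∧
    (∀ x ∈ Ioo (0 : ℝ) 1, ε ^ 4 * D 4 u₀ x + 4 * u₀ x = 0) ∧
    (∀ x ∈ Ioo (0 : ℝ) 1, ε ^ 4 * D 4 u₁ x + 4 * u₁ x = 0)

/-- The space `V = H^2_0(Ω) × H^2(Ω)`. -/
def V : Set ((ℝ → ℝ) × (ℝ → ℝ)) := {w | MemH20 w.1 ∧ MemH 2 w.2}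

/-- The bilinear form
`𝓑((u,v),(u⋆,v⋆)) = lam ⟨v - ε^{3/2} u'', v⋆ - ε^{3/2} u⋆''⟩
  + ⟨ε^{5/2} v'' + 4u, ε^{3/2} v⋆'' + 4u⋆⟩`. -/
def B (ε lam : ℝ) (w z : (ℝ → ℝ) × (ℝ → ℝ)) : ℝ :=
  lam * ip (fun x => w.2 x - ε ^ (3 / 2 : ℝ) * D 2 w.1 x)
           (fun x => z.2 x - ε ^ (3 / 2 : ℝ) * D 2 z.1 x)
    + ip (fun x => ε ^ (5 / 2 : ℝ) * D 2 w.2 x + 4 * w.1 x)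
         (fun x => ε ^ (3 / 2 : ℝ) * D 2 z.2 x + 4 * z.1 x)

/-- The linear functional `𝓕((u⋆,v⋆)) = ⟨f, ε^{3/2} v⋆'' + 4u⋆⟩`. -/
def F (ε : ℝ) (f : ℝ → ℝ) (z : (ℝ → ℝ) × (ℝ → ℝ)) : ℝ :=
  ip f (fun x => ε ^ (3 / 2 : ℝ) * D 2 z.2 x + 4 * z.1 x)

/-- The spline space `𝓢_p^k(ω)` over the partition `0 = x 0 < x 1 < ⋯ < x N = 1`: functions in
`C^k[0,1]` that are polynomials of degree at most `p` on each mesh interval. -/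
def Spline (p k N : ℕ) (x : ℕ → ℝ) : Set (ℝ → ℝ) :=
  {s | ContDiffOn ℝ k s (Icc 0 1) ∧
    ∀ i < N, ∃ q : Polynomial ℝ, q.natDegree ≤ p ∧
      ∀ t ∈ Ioo (x i) (x (i + 1)), s t = q.eval t}

/-- The transition point `τ = min {1/4, σ ε ln N}`. -/
def tau (ε σ : ℝ) (N : ℕ) : ℝ := min (1 / 4) (σ * ε * Real.log N)

/-- The nodes `x_0, …, x_N` of the Shishkin mesh, where `N` is a positive multiple of `4`:
`[0,τ]` and `[1-τ,1]` are dissected uniformly into `N/4` intervals each and `[τ,1-τ]` into `N/2`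
intervals. -/
def shishkin (ε σ : ℝ) (N : ℕ) (i : ℕ) : ℝ :=
  if i ≤ N / 4 then i * (tau ε σ N / (N / 4))
  else if i ≤ 3 * (N / 4) then
    tau ε σ N + ((i : ℝ) - N / 4) * ((1 - 2 * tau ε σ N) / (N / 2))
  else 1 - tau ε σ N + ((i : ℝ) - 3 * (N / 4)) * (tau ε σ N / (N / 4))

/-- The finite element space `V_h = 𝓢_p^1(ω)² ∩ V` on the Shishkin mesh `ω`. -/
def Vh (p : ℕ) (ε σ : ℝ) (N : ℕ) : Set ((ℝ → ℝ) × (ℝ → ℝ)) :=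
  {w | w.1 ∈ Spline p 1 N (shishkin ε σ N) ∧ w.2 ∈ Spline p 1 N (shishkin ε σ N)} ∩ V

/-- `(u_h, v_h) ∈ V_h` solves the discrete problem: `𝓑((u_h,v_h),z) = 𝓕(z)` for all `z ∈ V_h`. -/
def IsFEMSolution (p : ℕ) (ε lam σ : ℝ) (N : ℕ) (f uh vh : ℝ → ℝ) : Prop :=
  (uh, vh) ∈ Vh p ε σ N ∧ ∀ z ∈ Vh p ε σ N, B ε lam (uh, vh) z = F ε f z

/-- The error `‖u - u_h‖ + ‖ε^{3/2} u'' - v_h‖` in `L₂(Ω)`. -/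
def l2error (ε : ℝ) (u uh vh : ℝ → ℝ) : ℝ :=
  l2norm (fun x => u x - uh x) + l2norm (fun x => ε ^ (3 / 2 : ℝ) * D 2 u x - vh x)

end ShellFEM

end

/-! ### The `L₂` pairing, the space `H²` and Green's formula. -/

namespace ShellFEM

/-! Write `α = ε^{3/2}` and `v = α u''`. The method is consistent, since `v - α u'' = 0` and
`ε^{5/2} v'' + 4u = f`. Hence, for any discrete pair `(w, W)` with `(u_h - w, v_h - W) = (a, b) ∈
V_h`, the approximation errors `η = u - w`, `θ = v - W` satisfy `B((a,b),(a,b)) = B((η,θ),(a,b))`.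
For `λ ≥ 3` the left side dominates `‖a‖² + ‖b‖² + α²‖a''‖² + ε⁴‖b''‖²` (`coercivity_scalar`).

Green's formula, with `a` and `η` clamped, reduces the right side to `λ⟨θ,b⟩ + (4ε-λ)α⟨θ,a''⟩ +
λα²⟨η'',a''⟩ + ε⁴⟨θ'',b''⟩ + 16⟨η,a⟩ + (4-λ)α⟨η,b''⟩`. The second derivatives of the errors converge
only with order `p-1`, so the two pairings of second derivatives must not be estimated by norms. The
remedy is an interpolant that matches values and first derivatives at the nodes and whose second
derivative is, on each element, the `L₂`-projection of the given second derivative onto degree `p-2`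
(`exists_local_interp`). Its error has second derivative orthogonal to those of all splines, so the
regular component drops out of both pairings.

For a layer component the interpolant is used on the fine mesh at its end point, minus a cubic that
brings the data at the transition point to zero; beyond that point a cubic carries only the tiny
data at the far end (`exists_two_zone_approx`, `exists_layer_approx`). As `σ ≥ p+1`, these
corrections are as small as the interpolation error, and exponential decay contributes a factor `√ε`
to `L₂` norms. This is exactly what `α/ε² = ε^{-1/2}` costs, so the layers contribute `(N⁻¹ ln
N)^{p+1}` uniformly in `ε`.

What remains is `(4-λ)α⟨r,b''⟩` with the regular error `r`. It is at most `α‖r''‖‖b‖` and at most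
`ε^{-1/2}‖r‖ · ε²‖b''‖`, which produces the minimum in the bound (`norm_add_norm_le_of_form_eq`). -/

theorem ae_mem_Ioo : ∀ᵐ t ∂volΩ, t ∈ Ioo (0 : ℝ) 1 :=
  ae_restrict_mem measurableSet_Ioo

theorem ae_volΩ_iff {P : ℝ → Prop} :
    (∀ᵐ t ∂volΩ, P t) ↔ ∀ᵐ t : ℝ, t ∈ Ioo (0 : ℝ) 1 → P t :=
  ae_restrict_iff' measurableSet_Ioo

theorem ip_eq_integral (w z : ℝ → ℝ) : ip w z = ∫ x, w x * z x ∂volΩ := by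
  rw [ip, intervalIntegral.integral_of_le zero_le_one, integral_Ioc_eq_integral_Ioo]

theorem ip_congr {w w' z z' : ℝ → ℝ} (hw : w =ᵐ[volΩ] w') (hz : z =ᵐ[volΩ] z') :
    ip w z = ip w' z' := by
  rw [ip_eq_integral, ip_eq_integral]
  exact integral_congr_ae (hw.mul hz)

theorem l2norm_congr {w w' : ℝ → ℝ} (hw : w =ᵐ[volΩ] w') : l2norm w = l2norm w' := by
  rw [l2norm, l2norm, ip_congr hw hw]

theorem ip_eq_inner {w z : ℝ → ℝ} (hw : MemLp w 2 volΩ) (hz : MemLp z 2 volΩ) :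
    ip w z = inner ℝ (hw.toLp w) (hz.toLp z) := by
  rw [L2.inner_def, ip_eq_integral]
  refine integral_congr_ae ?_
  filter_upwards [hw.coeFn_toLp, hz.coeFn_toLp] with x h1 h2
  rw [h1, h2, real_inner_eq_re_inner, RCLike.inner_apply]
  simp [mul_comm]

theorem l2norm_eq_norm {w : ℝ → ℝ} (hw : MemLp w 2 volΩ) : l2norm w = ‖hw.toLp w‖ := by
  rw [l2norm, ip_eq_inner hw hw, real_inner_self_eq_norm_sq, Real.sqrt_sq (norm_nonneg _)]

theorem abs_ip_le {w z : ℝ → ℝ} (hw : MemLp w 2 volΩ) (hz : MemLp z 2 volΩ) :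
    |ip w z| ≤ l2norm w * l2norm z := by
  rw [ip_eq_inner hw hz, l2norm_eq_norm hw, l2norm_eq_norm hz]
  exact abs_real_inner_le_norm _ _

theorem l2norm_nonneg (w : ℝ → ℝ) : 0 ≤ l2norm w := Real.sqrt_nonneg _

theorem l2norm_le_of_ae_abs_le {w g : ℝ → ℝ} {c K : ℝ} (hc : 0 ≤ c) (hg : MemLp g 2 volΩ)
    (h : ∀ᵐ t ∂volΩ, |w t| ≤ c * g t) (hK : ip g g ≤ K ^ 2) (hK0 : 0 ≤ K) :
    l2norm w ≤ c * K := by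
  have h1 : ip w w ≤ c ^ 2 * ip g g := by
    rw [ip_eq_integral, ip_eq_integral, ← integral_const_mul]
    refine integral_mono_of_nonneg (.of_forall fun x => mul_self_nonneg _)
      ((hg.integrable_mul hg).const_mul _) ?_
    filter_upwards [h] with t ht
    have := abs_le.1 ht
    nlinarith [abs_mul_abs_self (w t), abs_nonneg (w t)]
  refine Real.sqrt_le_iff.2 ⟨by positivity, h1.trans ?_⟩
  nlinarith [sq_nonneg c, mul_le_mul_of_nonneg_left hK (sq_nonneg c)]

theorem uniqueDiffOn_unit : UniqueDiffOn ℝ (Icc (0 : ℝ) 1) := uniqueDiffOn_Icc zero_lt_one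

theorem D_succ (k : ℕ) (w : ℝ → ℝ) : D (k + 1) w = derivWithin (D k w) (Icc 0 1) :=
  iteratedDerivWithin_succ

theorem D_zero (w : ℝ → ℝ) : D 0 w = w := iteratedDerivWithin_zero

theorem memLp_of_continuousOn {w : ℝ → ℝ} (hw : ContinuousOn w (Icc 0 1)) : MemLp w 2 volΩ := by
  obtain ⟨K, hK⟩ := isCompact_Icc.exists_bound_of_continuousOn hw
  refine MemLp.of_bound ((hw.mono Ioo_subset_Icc_self).aestronglyMeasurable measurableSet_Ioo) K ?_
  filter_upwards [ae_mem_Ioo] with t ht using hK t (Ioo_subset_Icc_self ht)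

theorem continuousOn_of_hasDerivWithinAt {w w1 : ℝ → ℝ}
    (h : ∀ t ∈ Icc (0 : ℝ) 1, HasDerivWithinAt w (w1 t) (Icc 0 1) t) :
    ContinuousOn w (Icc 0 1) := fun t ht => (h t ht).continuousWithinAt

theorem derivWithin_eq_of_hasDerivAt {w : ℝ → ℝ} {c t : ℝ} (ht : t ∈ Icc (0 : ℝ) 1)
    (h : HasDerivAt w c t) : derivWithin w (Icc 0 1) t = c :=
  h.hasDerivWithinAt.derivWithin (uniqueDiffOn_unit t ht)

theorem MemH.hasDerivWithinAt {w : ℝ → ℝ} (hw : MemH 2 w) {t : ℝ} (ht : t ∈ Icc (0 : ℝ) 1) :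
    HasDerivWithinAt w (D 1 w t) (Icc 0 1) t := by
  have h := (hw.1.differentiableOn (by norm_num) t ht).hasDerivWithinAt
  rwa [D_succ, D_zero]

theorem MemH.memLp {w : ℝ → ℝ} (hw : MemH 2 w) : MemLp w 2 volΩ :=
  memLp_of_continuousOn hw.1.continuousOn

theorem MemH.memLp_D {w : ℝ → ℝ} (hw : MemH 2 w) : MemLp (D 2 w) 2 volΩ := hw.2.2

theorem MemH.ac_D {w : ℝ → ℝ} (hw : MemH 2 w) : AbsolutelyContinuousOnInterval (D 1 w) 0 1 :=
  hw.2.1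

theorem MemH.ac {w : ℝ → ℝ} (hw : MemH 2 w) : AbsolutelyContinuousOnInterval w 0 1 := by
  refine ContDiffOn.absolutelyContinuousOnInterval ?_
  rw [uIcc_of_le zero_le_one]
  exact_mod_cast hw.1

theorem MemH.ae_hasDerivAt {w : ℝ → ℝ} (hw : MemH 2 w) :
    ∀ᵐ t ∂volΩ, HasDerivAt (D 1 w) (D 2 w t) t := by
  rw [ae_volΩ_iff]
  filter_upwards [hw.ac_D.ae_differentiableAt] with t h ht
  have ht' := Ioo_subset_Icc_self ht
  have h1 := (h (by rwa [uIcc_of_le zero_le_one])).hasDerivAt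
  rw [D_succ 1, derivWithin_eq_of_hasDerivAt ht' h1]
  exact h1

/-- A criterion for `H²` in terms of given first and second derivatives. -/
theorem memH_two_of_hasDeriv {w w1 w2 : ℝ → ℝ}
    (h1 : ∀ t ∈ Icc (0 : ℝ) 1, HasDerivWithinAt w (w1 t) (Icc 0 1) t)
    (hac : AbsolutelyContinuousOnInterval w1 0 1)
    (h2 : ∀ᵐ t ∂volΩ, HasDerivAt w1 (w2 t) t) (hL : MemLp w2 2 volΩ) :
    MemH 2 w ∧ EqOn (D 1 w) w1 (Icc 0 1) ∧ D 2 w =ᵐ[volΩ] w2 := by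
  have e1 : EqOn (D 1 w) w1 (Icc 0 1) := fun t ht => by
    rw [D_succ, D_zero]
    exact (h1 t ht).derivWithin (uniqueDiffOn_unit t ht)
  have e2 : D 2 w =ᵐ[volΩ] w2 := by
    filter_upwards [h2, ae_mem_Ioo] with t ht hm
    have hm' := Ioo_subset_Icc_self hm
    rw [D_succ 1, derivWithin_congr e1 (e1 hm')]
    exact derivWithin_eq_of_hasDerivAt hm' ht
  have hc := hac.continuousOn
  rw [uIcc_of_le zero_le_one] at hc
  refine ⟨⟨?_, ?_, hL.ae_eq e2.symm⟩, e1, e2⟩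
  · have : ContDiffOn ℝ 1 w (Icc 0 1) := by
      rw [contDiffOn_one_iff_derivWithin uniqueDiffOn_unit]
      refine ⟨fun t ht => (h1 t ht).differentiableWithinAt, hc.congr fun t ht => ?_⟩
      exact (h1 t ht).derivWithin (uniqueDiffOn_unit t ht)
    exact_mod_cast this
  · rw [absolutelyContinuousOnInterval_iff] at hac ⊢
    intro e he
    obtain ⟨d, hd, h⟩ := hac e he
    refine ⟨d, hd, fun E hE hs => ?_⟩
    convert h E hE hs using 2 with i hi
    have := hE.1 i hi
    rw [uIcc_of_le zero_le_one] at this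
    rw [e1 this.1, e1 this.2]

theorem MemH.add_const_mul {w z : ℝ → ℝ} (hw : MemH 2 w) (hz : MemH 2 z) (c : ℝ) :
    MemH 2 (fun t => w t + c * z t) ∧
      EqOn (D 1 fun t => w t + c * z t) (fun t => D 1 w t + c * D 1 z t) (Icc 0 1) ∧
      D 2 (fun t => w t + c * z t) =ᵐ[volΩ] fun t => D 2 w t + c * D 2 z t := by
  refine memH_two_of_hasDeriv
    (fun t ht => (hw.hasDerivWithinAt ht).add ((hz.hasDerivWithinAt ht).const_mul c))
    (hw.ac_D.add (hz.ac_D.const_mul c)) ?_ (hw.memLp_D.add (hz.memLp_D.const_mul c))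
  filter_upwards [hw.ae_hasDerivAt, hz.ae_hasDerivAt] with t h1 h2 using h1.add (h2.const_mul c)

theorem MemH.add {w z : ℝ → ℝ} (hw : MemH 2 w) (hz : MemH 2 z) :
    MemH 2 (fun t => w t + z t) ∧
      EqOn (D 1 fun t => w t + z t) (fun t => D 1 w t + D 1 z t) (Icc 0 1) ∧
      D 2 (fun t => w t + z t) =ᵐ[volΩ] fun t => D 2 w t + D 2 z t := by
  simpa only [one_mul] using hw.add_const_mul hz 1

theorem MemH.sub {w z : ℝ → ℝ} (hw : MemH 2 w) (hz : MemH 2 z) :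
    MemH 2 (fun t => w t - z t) ∧
      EqOn (D 1 fun t => w t - z t) (fun t => D 1 w t - D 1 z t) (Icc 0 1) ∧
      D 2 (fun t => w t - z t) =ᵐ[volΩ] fun t => D 2 w t - D 2 z t := by
  simpa only [neg_one_mul, ← sub_eq_add_neg] using hw.add_const_mul hz (-1)

theorem Clamped.add {w z : ℝ → ℝ} (hw : MemH 2 w) (hz : MemH 2 z) (cw : Clamped w)
    (cz : Clamped z) : Clamped (fun t => w t + z t) := by
  intro ξ hξ
  have hm : ξ ∈ Icc (0 : ℝ) 1 := by rcases hξ with rfl | rfl <;> simp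
  refine ⟨by simp [(cw ξ hξ).1, (cz ξ hξ).1], ?_⟩
  rw [(hw.add hz).2.1 hm]
  simp [(cw ξ hξ).2, (cz ξ hξ).2]

theorem Clamped.sub {w z : ℝ → ℝ} (hw : MemH 2 w) (hz : MemH 2 z) (cw : Clamped w)
    (cz : Clamped z) : Clamped (fun t => w t - z t) := by
  intro ξ hξ
  have hm : ξ ∈ Icc (0 : ℝ) 1 := by rcases hξ with rfl | rfl <;> simp
  refine ⟨by simp [(cw ξ hξ).1, (cz ξ hξ).1], ?_⟩
  rw [(hw.sub hz).2.1 hm]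
  simp [(cw ξ hξ).2, (cz ξ hξ).2]

theorem integral_deriv_congr {w w1 z : ℝ → ℝ} (h : ∀ᵐ t ∂volΩ, HasDerivAt w (w1 t) t) :
    ∫ t in (0 : ℝ)..1, z t * deriv w t = ip z w1 :=
  ip_congr (Filter.EventuallyEq.refl _ z) (h.mono fun _ ht => ht.deriv)

theorem MemH.ae_hasDerivAt_one {w : ℝ → ℝ} (hw : MemH 2 w) :
    ∀ᵐ t ∂volΩ, HasDerivAt w (D 1 w t) t := by
  filter_upwards [ae_mem_Ioo] with t ht
  exact (hw.hasDerivWithinAt (Ioo_subset_Icc_self ht)).hasDerivAt (Icc_mem_nhds ht.1 ht.2)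

theorem ip_comm (w z : ℝ → ℝ) : ip w z = ip z w := by
  simp only [ip, mul_comm]

/-- Green's formula `⟨w'', z⟩ = ⟨w, z''⟩` for `w ∈ H²` and `z ∈ H²₀`. -/
theorem ip_D_two_comm {w z : ℝ → ℝ} (hw : MemH 2 w) (hz : MemH 2 z) (cz : Clamped z) :
    ip (D 2 w) z = ip w (D 2 z) := by
  have h0 := cz 0 (by simp)
  have h1 := cz 1 (by simp)
  -- One derivative is moved in each of the two pairings, so both meet in `⟨w', z'⟩`; every boundary
  -- term contains `z` or `z'`.
  have e1 := hz.ac.integral_mul_deriv_eq_deriv_mul hw.ac_D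
  have e2 := hw.ac.integral_mul_deriv_eq_deriv_mul hz.ac_D
  rw [integral_deriv_congr hw.ae_hasDerivAt] at e1
  rw [integral_deriv_congr hz.ae_hasDerivAt] at e2
  have e3 : ∫ t in (0 : ℝ)..1, deriv z t * D 1 w t = ip (D 1 z) (D 1 w) :=
    ip_congr (hz.ae_hasDerivAt_one.mono fun _ ht => ht.deriv) (Filter.EventuallyEq.refl _ _)
  have e4 : ∫ t in (0 : ℝ)..1, deriv w t * D 1 z t = ip (D 1 w) (D 1 z) :=
    ip_congr (hw.ae_hasDerivAt_one.mono fun _ ht => ht.deriv) (Filter.EventuallyEq.refl _ _)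
  rw [ip_comm, e1, e2, e3, e4, ip_comm (D 1 z), h0.1, h0.2, h1.1, h1.2]
  ring

/-! ### Chains of derivatives. -/

/-- `g 0, …, g n` are the successive derivatives of `g 0` on `[0,1]`. -/
def DerivChain (n : ℕ) (g : ℕ → ℝ → ℝ) : Prop :=
  ∀ k < n, ∀ t ∈ Icc (0 : ℝ) 1, HasDerivWithinAt (g k) (g (k + 1) t) (Icc 0 1) t

theorem derivChain_of_contDiffOn {n : ℕ} {w : ℝ → ℝ} (hw : ContDiffOn ℝ n w (Icc 0 1)) :
    DerivChain n fun k => D k w := by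
  intro k hk t ht
  have := (hw.differentiableOn_iteratedDerivWithin (m := k) (by exact_mod_cast hk)
    uniqueDiffOn_unit t ht).hasDerivWithinAt
  show HasDerivWithinAt (D k w) (D (k + 1) w t) (Icc 0 1) t
  rw [D_succ]
  exact this

/-- Used with `m = 2` for `α φ''`, which must itself be approximated to order `p+1`; this is why
`p+3` derivatives of the components are needed. -/
theorem DerivChain.const_mul_shift {n m : ℕ} {g : ℕ → ℝ → ℝ} (hg : DerivChain (n + m) g) (c : ℝ) :
    DerivChain n fun k t => c * g (k + m) t := by
  intro k hk t ht
  have := (hg (k + m) (by omega) t ht).const_mul c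
  rwa [show k + m + 1 = k + 1 + m by ring] at this

theorem DerivChain.continuousOn {n : ℕ} {g : ℕ → ℝ → ℝ} (hg : DerivChain n g) {k : ℕ}
    (hk : k < n) : ContinuousOn (g k) (Icc 0 1) :=
  continuousOn_of_hasDerivWithinAt (hg k hk)

theorem DerivChain.D_eqOn {n : ℕ} {g : ℕ → ℝ → ℝ} (hg : DerivChain n g) {k : ℕ} (hk : k ≤ n) :
    EqOn (D k (g 0)) (g k) (Icc 0 1) := by
  induction k with
  | zero => rw [D_zero]; exact eqOn_refl _ _
  | succ k ih =>
    intro t ht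
    rw [D_succ, derivWithin_congr (ih (by omega)) (ih (by omega) ht)]
    exact (hg k (by omega) t ht).derivWithin (uniqueDiffOn_unit t ht)

theorem DerivChain.memH_two {n : ℕ} {g : ℕ → ℝ → ℝ} (hg : DerivChain n g) (hn : 3 ≤ n) :
    MemH 2 (g 0) := by
  have hc : ∀ k < n, ContinuousOn (g k) (Icc 0 1) := fun k hk => hg.continuousOn hk
  refine (memH_two_of_hasDeriv (w1 := g 1) (w2 := g 2) (hg 0 (by omega)) ?_ ?_
    (memLp_of_continuousOn (hc 2 (by omega)))).1
  · refine ContDiffOn.absolutelyContinuousOnInterval ?_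
    rw [uIcc_of_le zero_le_one, contDiffOn_one_iff_derivWithin uniqueDiffOn_unit]
    refine ⟨fun t ht => (hg 1 (by omega) t ht).differentiableWithinAt,
      (hc 2 (by omega)).congr fun t ht => ?_⟩
    exact (hg 1 (by omega) t ht).derivWithin (uniqueDiffOn_unit t ht)
  · filter_upwards [ae_mem_Ioo] with t ht
    exact (hg 1 (by omega) t (Ioo_subset_Icc_self ht)).hasDerivAt (Icc_mem_nhds ht.1 ht.2)

/-! ### Approximation by polynomials on one interval. -/

open Polynomial

theorem exists_antiderivative {n : ℕ} (R : ℝ[X]) (hR : R.natDegree ≤ n) :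
    ∃ S : ℝ[X], S.natDegree ≤ n + 1 ∧ derivative S = R := by
  refine ⟨∑ i ∈ Finset.range (n + 1), monomial (i + 1) (R.coeff i / (i + 1)), ?_, ?_⟩
  · refine natDegree_sum_le_of_forall_le _ _ fun i hi => (natDegree_monomial_le _).trans ?_
    have := Finset.mem_range.1 hi
    omega
  · rw [derivative_sum]
    conv_rhs => rw [R.as_sum_range' (n + 1) (by omega)]
    refine Finset.sum_congr rfl fun i _ => ?_
    rw [derivative_monomial]
    congr 1
    push_cast
    field_simp

/-- Polynomial approximation of a function whose `n`-th derivative is bounded. -/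
theorem exists_poly_approx {n : ℕ} {a b G : ℝ} (hab : a ≤ b) (g : ℕ → ℝ → ℝ)
    (hg : ∀ k < n + 1, ∀ t ∈ Icc a b, HasDerivWithinAt (g k) (g (k + 1) t) (Icc a b) t)
    (hG : ∀ t ∈ Icc a b, |g (n + 1) t| ≤ G) :
    ∃ T : ℝ[X], T.natDegree ≤ n ∧ ∀ t ∈ Icc a b, |g 0 t - T.eval t| ≤ (b - a) ^ (n + 1) * G := by
  induction n generalizing g with
  | zero =>
    refine ⟨C (g 0 a), by simp, fun t ht => ?_⟩
    have := (convex_Icc a b).norm_image_sub_le_of_norm_hasDerivWithin_le (hg 0 (by omega)) hG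
      (left_mem_Icc.2 hab) ht
    rw [Real.norm_eq_abs, Real.norm_eq_abs, abs_of_nonneg (sub_nonneg.2 ht.1)] at this
    have hG0 : 0 ≤ G := (abs_nonneg _).trans (hG t ht)
    rw [eval_C, zero_add, pow_one, mul_comm]
    exact this.trans (mul_le_mul_of_nonneg_left (by linarith [ht.2]) hG0)
  | succ n ih =>
    obtain ⟨R, hR, hRe⟩ := ih (fun k => g (k + 1)) (fun k hk => hg (k + 1) (by omega)) hG
    obtain ⟨S, hS, hSd⟩ := exists_antiderivative R hR
    -- The constant makes the error vanish at `a`, so the mean value inequality turns the bound for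
    -- the derivative into one for the value, at the price of a factor `b - a`.
    refine ⟨S + C (g 0 a - S.eval a), by
      rw [natDegree_add_C]; exact hS, fun t ht => ?_⟩
    have hd : ∀ t ∈ Icc a b, HasDerivWithinAt (fun t => g 0 t - S.eval t) (g 1 t - R.eval t)
        (Icc a b) t := fun t ht => by
      have := (hg 0 (by omega) t ht).sub (S.hasDerivAt t).hasDerivWithinAt
      rwa [hSd] at this
    have := (convex_Icc a b).norm_image_sub_le_of_norm_hasDerivWithin_le hd hRe
      (left_mem_Icc.2 hab) ht
    rw [Real.norm_eq_abs, Real.norm_eq_abs, abs_of_nonneg (sub_nonneg.2 ht.1)] at this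
    have hG0 : 0 ≤ G := (abs_nonneg _).trans (hG t ht)
    have hba : 0 ≤ b - a := by linarith
    have h2 : (b - a) ^ (n + 1) * G * (t - a) ≤ (b - a) ^ (n + 1) * G * (b - a) :=
      mul_le_mul_of_nonneg_left (by linarith [ht.2]) (by positivity)
    rw [eval_add, eval_C]
    calc |g 0 t - (S.eval t + (g 0 a - S.eval a))|
        = |g 0 t - S.eval t - (g 0 a - S.eval a)| := by ring_nf
      _ ≤ _ := this
      _ ≤ _ := h2
      _ = _ := by ring

theorem integral_poly_sq_pos {a b : ℝ} (hab : a < b) {P : ℝ[X]}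
    (h : ∫ t in a..b, P.eval t * P.eval t = 0) : P = 0 := by
  by_contra hP
  have hc : Continuous fun t => P.eval t * P.eval t := P.continuous.mul P.continuous
  have hz : ∀ t ∈ Ioo a b, P.eval t = 0 := by
    by_contra! hne
    obtain ⟨t, ht, hne⟩ := hne
    have := intervalIntegral.integral_pos hab hc.continuousOn
      (fun x _ => mul_self_nonneg (P.eval x))
      ⟨t, Ioo_subset_Icc_self ht, mul_self_pos.2 hne⟩
    linarith
  exact hP (P.eq_zero_of_infinite_isRoot ((Ioo_infinite hab).mono fun t ht => hz t ht))

/-- The `L₂`-projection onto the polynomials of degree at most `n`. -/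
theorem exists_projection {a b : ℝ} (hab : a < b) (n : ℕ) {g : ℝ → ℝ}
    (hg : ContinuousOn g (Icc a b)) :
    ∃ P : ℝ[X], P.natDegree ≤ n ∧
      ∀ R : ℝ[X], R.natDegree ≤ n → ∫ t in a..b, (g t - P.eval t) * R.eval t = 0 := by
  have hI : ∀ {f : ℝ → ℝ}, ContinuousOn f (Icc a b) → IntervalIntegrable f volume a b :=
    fun hf => ContinuousOn.intervalIntegrable (by rwa [uIcc_of_le hab.le])
  let E := degreeLT ℝ (n + 1)
  have hM : ∀ {f : ℝ → ℝ}, ContinuousOn f (Icc a b) → ∀ R : ℝ[X],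
      IntervalIntegrable (fun t => f t * R.eval t) volume a b :=
    fun hf R => hI (hf.mul R.continuousOn)
  let φ : E →ₗ[ℝ] ℝ :=
    { toFun := fun R => ∫ t in a..b, g t * (R : ℝ[X]).eval t
      map_add' := fun R S => by
        rw [← intervalIntegral.integral_add (hM hg R) (hM hg S)]
        simp [mul_add]
      map_smul' := fun c R => by
        simp only [RingHom.id_apply, smul_eq_mul]
        rw [← intervalIntegral.integral_const_mul]
        simp [mul_left_comm] }
  let Φ : E →ₗ[ℝ] E →ₗ[ℝ] ℝ :=
    LinearMap.mk₂ ℝ (fun P R => ∫ t in a..b, (P : ℝ[X]).eval t * (R : ℝ[X]).eval t)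
      (fun P Q R => by
        rw [← intervalIntegral.integral_add (hM (P : ℝ[X]).continuousOn R)
          (hM (Q : ℝ[X]).continuousOn R)]
        simp [add_mul])
      (fun c P R => by
        rw [smul_eq_mul, ← intervalIntegral.integral_const_mul]
        simp [mul_assoc])
      (fun P R S => by
        rw [← intervalIntegral.integral_add (hM (P : ℝ[X]).continuousOn R)
          (hM (P : ℝ[X]).continuousOn S)]
        simp [mul_add])
      (fun c P R => by
        rw [smul_eq_mul, ← intervalIntegral.integral_const_mul]
        simp [mul_left_comm])
  have hfd : FiniteDimensional ℝ E := (degreeLTEquiv ℝ (n + 1)).symm.finiteDimensional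
  -- The form is definite on polynomials, and in finite dimension injectivity into the dual gives
  -- surjectivity: the projection is the Riesz representative of `φ`.
  have hinj : Function.Injective Φ := by
    rw [injective_iff_map_eq_zero]
    intro P hP
    have : Φ P P = 0 := by rw [hP]; rfl
    exact Subtype.ext (integral_poly_sq_pos hab this)
  have hsurj := (LinearMap.injective_iff_surjective_of_finrank_eq_finrank
    Subspace.dual_finrank_eq.symm).1 hinj
  obtain ⟨P, hP⟩ := hsurj φ
  have hdeg : ∀ R : ℝ[X], R ∈ degreeLT ℝ (n + 1) ↔ R.natDegree ≤ n := fun R => by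
    rw [mem_degreeLT, natDegree_le_iff_degree_le, Nat.cast_add, Nat.cast_one]
    by_cases h : R = 0
    · simp [h]
    · rw [degree_eq_natDegree h]; norm_cast; omega
  refine ⟨P, (hdeg _).1 P.2, fun R hR => ?_⟩
  have h : ∫ t in a..b, (P : ℝ[X]).eval t * R.eval t = ∫ t in a..b, g t * R.eval t :=
    LinearMap.congr_fun hP ⟨R, (hdeg _).2 hR⟩
  simp only [sub_mul]
  rw [intervalIntegral.integral_sub (hM hg R)
    (hM (P : ℝ[X]).continuousOn R), h, sub_self]

theorem integral_eq_sub_of_hasDerivWithinAt {a b : ℝ} (hab : a ≤ b) {f f' : ℝ → ℝ}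
    (hf : ∀ t ∈ Icc a b, HasDerivWithinAt f (f' t) (Icc a b) t) (hc : ContinuousOn f' (Icc a b)) :
    ∫ t in a..b, f' t = f b - f a :=
  intervalIntegral.integral_eq_sub_of_hasDerivAt_of_le hab
    (fun t ht => (hf t ht).continuousWithinAt)
    (fun t ht => (hf t (Ioo_subset_Icc_self ht)).hasDerivAt (Icc_mem_nhds ht.1 ht.2))
    (ContinuousOn.intervalIntegrable (by rwa [uIcc_of_le hab]))

/-- Cauchy–Schwarz against the constant function, obtained from the nonnegative variance of `|f|`.
-/
theorem integral_abs_le_of_integral_sq_le {a b c : ℝ} (hab : a < b) (hc : 0 ≤ c) {f : ℝ → ℝ}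
    (hf : ContinuousOn f (Icc a b)) (h : ∫ t in a..b, f t ^ 2 ≤ (b - a) * c ^ 2) :
    ∫ t in a..b, |f t| ≤ (b - a) * c := by
  have hI : ∀ {f : ℝ → ℝ}, ContinuousOn f (Icc a b) → IntervalIntegrable f volume a b :=
    fun hf => ContinuousOn.intervalIntegrable (by rwa [uIcc_of_le hab.le])
  set A := ∫ t in a..b, |f t| with hA
  set m := A / (b - a) with hm
  have hba : 0 < b - a := sub_pos.2 hab
  have h0 : 0 ≤ ∫ t in a..b, (|f t| - m) ^ 2 :=
    intervalIntegral.integral_nonneg hab.le fun t _ => sq_nonneg _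
  have h1 : ∫ t in a..b, (|f t| - m) ^ 2 = (∫ t in a..b, f t ^ 2) - 2 * m * A + (b - a) * m ^ 2 := by
    have : ∀ t, (|f t| - m) ^ 2 = (f t ^ 2 - 2 * m * |f t|) + m ^ 2 := fun t => by
      rw [← sq_abs (f t)]; ring
    simp only [this]
    have i1 : IntervalIntegrable (fun t => f t ^ 2) volume a b := hI (hf.pow 2)
    have i2 : IntervalIntegrable (fun t => 2 * m * |f t|) volume a b := (hI hf.abs).const_mul _
    rw [intervalIntegral.integral_add (i1.sub i2) intervalIntegrable_const,
      intervalIntegral.integral_sub i1 i2, intervalIntegral.integral_const_mul,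
      intervalIntegral.integral_const, smul_eq_mul]
  have h2 : A = (b - a) * m := by rw [hm]; field_simp
  have h3 : m ^ 2 ≤ c ^ 2 := by
    rw [h1, h2] at h0
    nlinarith
  rw [h2]
  exact mul_le_mul_of_nonneg_left (abs_le_of_sq_le_sq' h3 hc).2 hba.le

/-- Interpolation of Hermite data at both end points by a polynomial whose second derivative is
the `L₂`-projection of the second derivative of the function. -/
theorem exists_local_interp {p : ℕ} (hp : 3 ≤ p) {a b G : ℝ} (hab : a < b) (g : ℕ → ℝ → ℝ)
    (hg : ∀ k < p + 1, ∀ t ∈ Icc a b, HasDerivWithinAt (g k) (g (k + 1) t) (Icc a b) t)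
    (hG : ∀ t ∈ Icc a b, |g (p + 1) t| ≤ G) :
    ∃ Q : ℝ[X], Q.natDegree ≤ p ∧
      (Q.eval a = g 0 a ∧ (derivative Q).eval a = g 1 a) ∧
      (Q.eval b = g 0 b ∧ (derivative Q).eval b = g 1 b) ∧
      (∀ R : ℝ[X], R.natDegree ≤ p - 2 →
        ∫ t in a..b, (g 2 t - (derivative (derivative Q)).eval t) * R.eval t = 0) ∧
      (∀ t ∈ Icc a b, |g 0 t - Q.eval t| ≤ (b - a) ^ (p + 1) * G) ∧
      ∫ t in a..b, (g 2 t - (derivative (derivative Q)).eval t) ^ 2 ≤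
        (b - a) * ((b - a) ^ (p - 1) * G) ^ 2 := by
  obtain ⟨n, rfl⟩ : ∃ n, p = n + 2 := ⟨p - 2, by omega⟩
  simp only [show n + 2 - 2 = n by omega, show n + 2 - 1 = n + 1 by omega]
  have hba : 0 < b - a := sub_pos.2 hab
  have hG0 : 0 ≤ G := (abs_nonneg _).trans (hG a (left_mem_Icc.2 hab.le))
  have hcont : ∀ k < n + 2 + 1, ContinuousOn (g k) (Icc a b) :=
    fun k hk t ht => (hg k hk t ht).continuousWithinAt
  -- `Q` is the projection of the second derivative integrated twice from `a`, with the data at `a`.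
  -- The data at `b` are then consequences of orthogonality.
  obtain ⟨P, hP, hPo⟩ := exists_projection hab n (hcont 2 (by omega))
  obtain ⟨S, hS, hSd⟩ := exists_antiderivative P hP
  set S' := S + C (g 1 a - S.eval a) with hS'
  have hSd' : derivative S' = P := by rw [hS', derivative_add, derivative_C, add_zero, hSd]
  obtain ⟨W, hW, hWd⟩ := exists_antiderivative S' (n := n + 1) (by rwa [hS', natDegree_add_C])
  set Q := W + C (g 0 a - W.eval a) with hQ
  have hQd : derivative Q = S' := by rw [hQ, derivative_add, derivative_C, add_zero, hWd]
  have hQa : Q.eval a = g 0 a := by simp [hQ]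
  have hQa' : S'.eval a = g 1 a := by simp [hS']
  refine ⟨Q, by rwa [hQ, natDegree_add_C], ?_⟩
  rw [hQd, hSd']
  set e0 : ℝ → ℝ := fun t => g 0 t - Q.eval t with he0
  set e1 : ℝ → ℝ := fun t => g 1 t - S'.eval t with he1
  set e2 : ℝ → ℝ := fun t => g 2 t - P.eval t with he2
  have d0 : ∀ t ∈ Icc a b, HasDerivWithinAt e0 (e1 t) (Icc a b) t := fun t ht => by
    have := (hg 0 (by omega) t ht).sub (Q.hasDerivAt t).hasDerivWithinAt
    rwa [hQd] at this
  have d1 : ∀ t ∈ Icc a b, HasDerivWithinAt e1 (e2 t) (Icc a b) t := fun t ht => by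
    have := (hg 1 (by omega) t ht).sub (S'.hasDerivAt t).hasDerivWithinAt
    rwa [hSd'] at this
  have c2 : ContinuousOn e2 (Icc a b) := (hcont 2 (by omega)).sub P.continuousOn
  have c1 : ContinuousOn e1 (Icc a b) := fun t ht => (d1 t ht).continuousWithinAt
  have e0a : e0 a = 0 := by simp [he0, hQa]
  have e1a : e1 a = 0 := by simp [he1, hQa']
  -- Orthogonality of `e2` to the constant `1`.
  have e1b : e1 b = 0 := by
    have h := hPo 1 (by simp)
    simp only [eval_one, mul_one] at h
    rw [integral_eq_sub_of_hasDerivWithinAt hab.le d1 c2] at h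
    linarith
  have e0b : e0 b = 0 := by
    -- Orthogonality of `e2` to `b - t`, integrated by parts. This is a legitimate test polynomial
    -- because `p - 2 ≥ 1`.
    by_cases hn : n = 0
    · omega
    have h := hPo (C b - X) ((natDegree_sub_le _ _).trans (by simp; omega))
    have hd : ∀ t ∈ Icc a b, HasDerivWithinAt (fun t => e1 t * (C b - X : ℝ[X]).eval t + e0 t)
        ((g 2 t - P.eval t) * (C b - X : ℝ[X]).eval t) (Icc a b) t := fun t ht => by
      have := ((d1 t ht).mul ((C b - X : ℝ[X]).hasDerivAt t).hasDerivWithinAt).add (d0 t ht)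
      refine this.congr_deriv ?_
      simp only [he2, derivative_sub, derivative_C, derivative_X, eval_sub, eval_C, eval_X,
        eval_zero, eval_one]
      ring
    rw [integral_eq_sub_of_hasDerivWithinAt hab.le hd (c2.mul (C b - X : ℝ[X]).continuousOn)] at h
    simp only [e0a, e1a, eval_sub, eval_C, eval_X] at h
    linarith
  obtain ⟨T, hT, hTe⟩ := exists_poly_approx (n := n) (G := G) hab.le (fun k => g (k + 2))
    (fun k hk => hg (k + 2) (by omega)) hG
  set c := (b - a) ^ (n + 1) * G with hc
  have hc0 : 0 ≤ c := by positivity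
  have hI : ∀ {f : ℝ → ℝ}, ContinuousOn f (Icc a b) → IntervalIntegrable f volume a b :=
    fun hf => ContinuousOn.intervalIntegrable (by rwa [uIcc_of_le hab.le])
  have hsq : ∫ t in a..b, e2 t ^ 2 ≤ (b - a) * c ^ 2 := by
    -- Best approximation: adding the vanishing integral of `2 e2 (P - T)` completes the square, and
    -- `e2 + (P - T) = g 2 - T`.
    have h := hPo (C 2 * (P - T)) (
      (natDegree_C_mul_le _ _).trans ((natDegree_sub_le _ _).trans (max_le hP hT)))
    have h1 : ∫ t in a..b, e2 t ^ 2 = ∫ t in a..b, (e2 t ^ 2 + e2 t * (C 2 * (P - T)).eval t) := by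
      have i1 : IntervalIntegrable (fun t => e2 t ^ 2) volume a b := hI (c2.pow 2)
      have i2 : IntervalIntegrable (fun t => e2 t * (C 2 * (P - T)).eval t) volume a b :=
        hI (c2.mul (C 2 * (P - T)).continuousOn)
      rw [intervalIntegral.integral_add i1 i2, h, add_zero]
    have h2 : ∫ t in a..b, (e2 t ^ 2 + e2 t * (C 2 * (P - T)).eval t) ≤ ∫ t in a..b, c ^ 2 := by
      refine intervalIntegral.integral_mono_on hab.le
        (hI ((c2.pow 2).add (c2.mul (C 2 * (P - T)).continuousOn))) intervalIntegrable_const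
        fun t ht => ?_
      have h3 := sq_le_sq' (abs_le.1 (hTe t ht)).1 (abs_le.1 (hTe t ht)).2
      simp only [he2, eval_mul, eval_sub, eval_C]
      nlinarith [sq_nonneg (P.eval t - T.eval t)]
    rw [h1]
    simpa using h2
  have hab1 := integral_abs_le_of_integral_sq_le hab hc0 c2 hsq
  have b1 : ∀ t ∈ Icc a b, |e1 t| ≤ (b - a) * c := fun t ht => by
    have hsub : Icc a t ⊆ Icc a b := Icc_subset_Icc_right ht.2
    have h := integral_eq_sub_of_hasDerivWithinAt ht.1
      (fun s hs => (d1 s (hsub hs)).mono hsub) (c2.mono hsub)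
    rw [e1a, sub_zero] at h
    rw [← h]
    refine (intervalIntegral.abs_integral_le_integral_abs ht.1).trans (le_trans ?_ hab1)
    exact intervalIntegral.integral_mono_interval le_rfl ht.1 ht.2
      (.of_forall fun s => abs_nonneg _) (hI c2.abs)
  refine ⟨⟨hQa, hQa'⟩, ⟨by linarith, ?_⟩, hPo, fun t ht => ?_, hsq⟩
  · linarith
  · have h := (convex_Icc a b).norm_image_sub_le_of_norm_hasDerivWithin_le d0 b1
      (left_mem_Icc.2 hab.le) ht
    rw [e0a, sub_zero, Real.norm_eq_abs, Real.norm_eq_abs, abs_of_nonneg (sub_nonneg.2 ht.1)] at h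
    refine h.trans ?_
    calc (b - a) * c * (t - a) ≤ (b - a) * c * (b - a) :=
          mul_le_mul_of_nonneg_left (by linarith [ht.2]) (by positivity)
      _ = _ := by rw [hc]; ring

/-! ### Meshes and the gluing of polynomial pieces. -/

/-- `0 = x 0 < x 1 < ⋯ < x N = 1`. -/
structure IsMesh (N : ℕ) (x : ℕ → ℝ) : Prop where
  zero : x 0 = 0
  one : x N = 1
  lt : ∀ i < N, x i < x (i + 1)

namespace IsMesh

variable {N : ℕ} {x : ℕ → ℝ}

theorem le (hx : IsMesh N x) {i j : ℕ} (hij : i ≤ j) (hj : j ≤ N) : x i ≤ x j := by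
  induction j, hij using Nat.le_induction with
  | base => exact le_rfl
  | succ j _ ih => exact (ih (by omega)).trans (hx.lt j (by omega)).le

theorem pos (hx : IsMesh N x) : 0 < N := by
  rcases Nat.eq_zero_or_pos N with rfl | h
  · have := hx.zero.symm.trans hx.one
    norm_num at this
  · exact h

theorem mem_unit (hx : IsMesh N x) {i : ℕ} (hi : i ≤ N) : x i ∈ Icc (0 : ℝ) 1 :=
  ⟨hx.zero ▸ hx.le (Nat.zero_le i) hi, hx.one ▸ hx.le hi le_rfl⟩

theorem Icc_subset (hx : IsMesh N x) {i : ℕ} (hi : i < N) :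
    Icc (x i) (x (i + 1)) ⊆ Icc 0 1 :=
  Icc_subset_Icc (hx.mem_unit hi.le).1 (hx.mem_unit hi).2

theorem Ioo_subset (hx : IsMesh N x) {i : ℕ} (hi : i < N) :
    Ioo (x i) (x (i + 1)) ⊆ Ioo 0 1 :=
  Ioo_subset_Ioo (hx.mem_unit hi.le).1 (hx.mem_unit hi).2

theorem exists_mem_Ico (hx : IsMesh N x) {t : ℝ} (h0 : 0 ≤ t) (h1 : t < 1) :
    ∃ i < N, t ∈ Ico (x i) (x (i + 1)) := by
  have : ∀ n, t < x n → ∃ i < n, t ∈ Ico (x i) (x (i + 1)) := by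
    intro n
    induction n with
    | zero => intro h; rw [hx.zero] at h; linarith
    | succ n ih =>
      intro h
      by_cases hn : t < x n
      · obtain ⟨i, hi, ht⟩ := ih hn
        exact ⟨i, by omega, ht⟩
      · exact ⟨n, by omega, not_lt.1 hn, h⟩
  exact this N (hx.one ▸ h1)

theorem exists_mem_Icc (hx : IsMesh N x) {t : ℝ} (ht : t ∈ Icc (0 : ℝ) 1) :
    ∃ i < N, t ∈ Icc (x i) (x (i + 1)) := by
  rcases ht.2.lt_or_eq with h | rfl
  · obtain ⟨i, hi, h⟩ := hx.exists_mem_Ico ht.1 h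
    exact ⟨i, hi, Ico_subset_Icc_self h⟩
  · have := hx.pos
    refine ⟨N - 1, by omega, ?_⟩
    have h1 : N - 1 + 1 = N := by omega
    rw [h1, hx.one]
    exact ⟨(hx.mem_unit (by omega)).2, le_rfl⟩

theorem integral_eq_sum (hx : IsMesh N x) {f : ℝ → ℝ}
    (hf : IntervalIntegrable f volume 0 1) :
    ∫ t in (0 : ℝ)..1, f t = ∑ i ∈ Finset.range N, ∫ t in x i..x (i + 1), f t := by
  rw [intervalIntegral.sum_integral_adjacent_intervals, hx.zero, hx.one]
  intro i hi
  refine hf.mono_set ?_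
  rw [uIcc_of_le zero_le_one, uIcc_of_le (hx.lt i hi).le]
  exact hx.Icc_subset hi

end IsMesh

theorem eqOn_D_of_eqOn_Ioo {w : ℝ → ℝ} {q : ℝ[X]} {a b : ℝ} (hab : Ioo a b ⊆ Ioo (0 : ℝ) 1)
    (h : ∀ t ∈ Ioo a b, w t = q.eval t) {t : ℝ} (ht : t ∈ Ioo a b) :
    D 1 w t = (derivative q).eval t := by
  rw [D_succ, D_zero]
  refine derivWithin_eq_of_hasDerivAt (Ioo_subset_Icc_self (hab ht)) ?_
  refine (q.hasDerivAt t).congr_of_eventuallyEq ?_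
  filter_upwards [Ioo_mem_nhds ht.1 ht.2] with s hs using h s hs

theorem eqOn_D_two_of_eqOn_Ioo {w : ℝ → ℝ} {q : ℝ[X]} {a b : ℝ} (hab : Ioo a b ⊆ Ioo (0 : ℝ) 1)
    (h : ∀ t ∈ Ioo a b, w t = q.eval t) {t : ℝ} (ht : t ∈ Ioo a b) :
    D 2 w t = (derivative (derivative q)).eval t := by
  rw [D_succ]
  refine derivWithin_eq_of_hasDerivAt (Ioo_subset_Icc_self (hab ht)) ?_
  refine ((derivative q).hasDerivAt t).congr_of_eventuallyEq ?_
  filter_upwards [Ioo_mem_nhds ht.1 ht.2] with s hs using eqOn_D_of_eqOn_Ioo hab h hs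

/-- Freezing the argument left of `c` keeps the function differentiable precisely because the slope
at `c` is zero. Jumps between adjacent spline pieces have this property. -/
theorem hasDerivAt_eval_max {P : ℝ[X]} {c : ℝ} (h1 : (derivative P).eval c = 0) (t : ℝ) :
    HasDerivAt (fun t => P.eval (max t c)) ((derivative P).eval (max t c)) t := by
  rcases lt_trichotomy t c with h | rfl | h
  · rw [max_eq_right h.le, h1]
    refine (hasDerivAt_const t (P.eval c)).congr_of_eventuallyEq ?_
    filter_upwards [Iio_mem_nhds h] with s hs
    rw [max_eq_right (le_of_lt hs)]
  · rw [max_self, ← hasDerivWithinAt_univ, ← Iic_union_Ici (a := t)]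
    refine HasDerivWithinAt.union ?_ ?_
    · rw [h1]
      refine (hasDerivWithinAt_const t _ (P.eval t)).congr (fun s hs => ?_) (by rw [max_self])
      rw [max_eq_right hs]
    · refine (P.hasDerivAt t).hasDerivWithinAt.congr (fun s hs => ?_) (by rw [max_self])
      rw [max_eq_left hs]
  · rw [max_eq_left h.le]
    refine (P.hasDerivAt t).congr_of_eventuallyEq ?_
    filter_upwards [Ioi_mem_nhds h] with s hs
    rw [max_eq_left (le_of_lt hs)]

theorem exists_lipschitzOnWith_eval_max (P : ℝ[X]) {c : ℝ} (hc : c ∈ Icc (0 : ℝ) 1) :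
    ∃ K, LipschitzOnWith K (fun t => P.eval (max t c)) (Icc 0 1) := by
  obtain ⟨K, hK⟩ := (P.contDiff_aeval (𝕜 := ℝ) 1).contDiffOn.exists_lipschitzOnWith (by decide)
    (convex_Icc (0 : ℝ) 1) isCompact_Icc
  simp only [coe_aeval_eq_eval] at hK
  refine ⟨K * 1, hK.comp ((LipschitzWith.id.max_const c).lipschitzOnWith) fun t ht => ?_⟩
  exact ⟨ht.1.trans (le_max_left _ _), max_le ht.2 hc.2⟩

theorem memH_two_of_lipschitzOn {w w1 : ℝ → ℝ} {K : NNReal}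
    (h1 : ∀ t ∈ Icc (0 : ℝ) 1, HasDerivWithinAt w (w1 t) (Icc 0 1) t)
    (hK : LipschitzOnWith K w1 (Icc 0 1)) :
    MemH 2 w ∧ EqOn (D 1 w) w1 (Icc 0 1) := by
  have hac : AbsolutelyContinuousOnInterval w1 0 1 := by
    refine LipschitzOnWith.absolutelyContinuousOnInterval (K := K) ?_
    rwa [uIcc_of_le zero_le_one]
  have h := memH_two_of_hasDeriv h1 hac (w2 := deriv w1) ?_ ?_
  · exact ⟨h.1, h.2.1⟩
  · rw [ae_volΩ_iff]
    filter_upwards [hac.ae_differentiableAt] with t h ht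
    exact (h (by rw [uIcc_of_le zero_le_one]; exact Ioo_subset_Icc_self ht)).hasDerivAt
  · refine MemLp.of_bound (measurable_deriv w1).aestronglyMeasurable K ?_
    filter_upwards [ae_mem_Ioo] with t ht
    exact norm_deriv_le_of_lipschitzOn (Icc_mem_nhds ht.1 ht.2) hK

/-- A `C¹` spline from matching polynomial pieces. -/
theorem exists_glue {p N : ℕ} {x : ℕ → ℝ} (hx : IsMesh N x) (Q : ℕ → ℝ[X])
    (hQ : ∀ i < N, (Q i).natDegree ≤ p)
    (hm : ∀ i, i + 1 < N → (Q i).eval (x (i + 1)) = (Q (i + 1)).eval (x (i + 1)) ∧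
      (derivative (Q i)).eval (x (i + 1)) = (derivative (Q (i + 1))).eval (x (i + 1))) :
    ∃ s, s ∈ Spline p 1 N x ∧ MemH 2 s ∧
      ∀ i < N, ∀ t ∈ Icc (x i) (x (i + 1)),
        s t = (Q i).eval t ∧ D 1 s t = (derivative (Q i)).eval t := by
  -- A truncated power representation: the jump across each interior node is switched on by `max`.
  -- Its value and slope vanish at the node, hence it is zero to the left and the sum is `C¹` with
  -- Lipschitz derivative.
  set s : ℝ → ℝ := fun t => (Q 0).eval t +
    ∑ j ∈ Finset.range (N - 1), (Q (j + 1) - Q j).eval (max t (x (j + 1))) with hs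
  set s1 : ℝ → ℝ := fun t => (derivative (Q 0)).eval t +
    ∑ j ∈ Finset.range (N - 1), (derivative (Q (j + 1) - Q j)).eval (max t (x (j + 1))) with hs1
  have hd : ∀ t, HasDerivAt s (s1 t) t := fun t => by
    refine ((Q 0).hasDerivAt t).add (HasDerivAt.fun_sum fun j hj => hasDerivAt_eval_max ?_ t)
    have := (hm j (by have := Finset.mem_range.1 hj; omega)).2
    simp [this]
  have hlip : ∃ K, LipschitzOnWith K s1 (Icc 0 1) := by
    obtain ⟨K0, h0⟩ := ((derivative (Q 0)).contDiff_aeval (𝕜 := ℝ) 1).contDiffOn.exists_lipschitzOnWith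
      (by decide) (convex_Icc (0 : ℝ) 1) isCompact_Icc
    simp only [coe_aeval_eq_eval] at h0
    have hsum : ∀ n ≤ N - 1, ∃ K, LipschitzOnWith K (fun t => ∑ j ∈ Finset.range n,
        (derivative (Q (j + 1) - Q j)).eval (max t (x (j + 1)))) (Icc 0 1) := by
      intro n hn
      induction n with
      | zero => exact ⟨0, by simp⟩
      | succ n ih =>
        obtain ⟨K1, h1⟩ := ih (by omega)
        obtain ⟨K2, h2⟩ := exists_lipschitzOnWith_eval_max (derivative (Q (n + 1) - Q n))
          (hx.mem_unit (i := n + 1) (by omega))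
        simp only [Finset.sum_range_succ]
        exact ⟨_, h1.add h2⟩
    obtain ⟨K1, h1⟩ := hsum (N - 1) le_rfl
    exact ⟨_, h0.add h1⟩
  obtain ⟨K, hK⟩ := hlip
  obtain ⟨hmem, hD⟩ := memH_two_of_lipschitzOn (fun t _ => (hd t).hasDerivWithinAt) hK
  have tele : ∀ (A : ℕ → ℝ[X]), (∀ j, j + 1 < N → (A j).eval (x (j + 1)) =
      (A (j + 1)).eval (x (j + 1))) → ∀ i < N, ∀ t ∈ Icc (x i) (x (i + 1)),
      (A 0).eval t + ∑ j ∈ Finset.range (N - 1), (A (j + 1) - A j).eval (max t (x (j + 1))) =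
        (A i).eval t := by
    intro A hA i hi t ht
    -- On element `i` the jumps at nodes up to `x i` are active and telescope; the later ones are
    -- frozen at their nodes, where they vanish.
    rw [← Finset.sum_range_add_sum_Ico _ (show i ≤ N - 1 by omega),
      Finset.sum_eq_zero (s := Finset.Ico i (N - 1))]
    · have : ∀ j ∈ Finset.range i, (A (j + 1) - A j).eval (max t (x (j + 1))) =
          (A (j + 1)).eval t - (A j).eval t := fun j hj => by
        have hj := Finset.mem_range.1 hj
        rw [max_eq_left ((hx.le (show j + 1 ≤ i by omega) hi.le).trans ht.1), eval_sub]
      rw [Finset.sum_congr rfl this, Finset.sum_range_sub (fun j => (A j).eval t)]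
      ring
    · intro j hj
      have hj := Finset.mem_Ico.1 hj
      rw [max_eq_right (ht.2.trans (hx.le (show i + 1 ≤ j + 1 by omega) (by omega))), eval_sub,
        hA j (by omega), sub_self]
  have hval : ∀ i < N, ∀ t ∈ Icc (x i) (x (i + 1)), s t = (Q i).eval t :=
    tele Q fun j hj => (hm j hj).1
  refine ⟨s, ⟨hmem.1, fun i hi => ⟨Q i, hQ i hi, fun t ht => ?_⟩⟩, hmem, fun i hi t ht =>
    ⟨hval i hi t ht, ?_⟩⟩
  · exact hval i hi t (Ioo_subset_Icc_self ht)
  · rw [hD (hx.Icc_subset hi ht), ← tele (fun i => derivative (Q i)) (fun j hj => (hm j hj).2) i hi t ht]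
    simp [hs1]

/-! ### Global spline approximation with orthogonal second derivatives. -/

theorem intervalIntegrable_mul {w z : ℝ → ℝ} (hw : MemLp w 2 volΩ) (hz : MemLp z 2 volΩ) :
    IntervalIntegrable (fun t => w t * z t) volume 0 1 := by
  rw [intervalIntegrable_iff_integrableOn_Ioo_of_le zero_le_one]
  exact hw.integrable_mul hz

theorem l2norm_abs (w : ℝ → ℝ) : l2norm (fun t => |w t|) = l2norm w := by
  simp only [l2norm, ip, abs_mul_abs_self]

theorem natDegree_derivative_derivative_le {p : ℕ} {q : ℝ[X]} (hq : q.natDegree ≤ p) :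
    (derivative (derivative q)).natDegree ≤ p - 2 := by
  have h1 := natDegree_derivative_le q
  have h2 := natDegree_derivative_le (derivative q)
  omega

/-- If `E = w'' - s''` is piecewise the sum of a part orthogonal to the second derivatives of
splines and a part bounded by `r`, then the functional `⟨E, a''⟩` is bounded by `r`. -/
theorem abs_ip_le_of_piecewise {p N : ℕ} {x : ℕ → ℝ} (hx : IsMesh N x) {E r a : ℝ → ℝ}
    (hE : MemLp E 2 volΩ) (hr : ContinuousOn r (Icc 0 1)) (ha : a ∈ Spline p 1 N x)
    (ha2 : MemH 2 a)
    (h : ∀ i < N, ∃ e ρ : ℝ → ℝ, ContinuousOn e (Icc (x i) (x (i + 1))) ∧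
      ContinuousOn ρ (Icc (x i) (x (i + 1))) ∧
      (∀ t ∈ Ioo (x i) (x (i + 1)), E t = e t + ρ t) ∧
      (∀ R : ℝ[X], R.natDegree ≤ p - 2 → ∫ t in x i..x (i + 1), e t * R.eval t = 0) ∧
      ∀ t ∈ Ioo (x i) (x (i + 1)), |ρ t| ≤ r t) :
    |ip E (D 2 a)| ≤ l2norm r * l2norm (D 2 a) := by
  have hrL := memLp_of_continuousOn hr
  have habs : MemLp (fun t => |D 2 a t|) 2 volΩ := ha2.memLp_D.abs
  calc |ip E (D 2 a)| ≤ ip r (fun t => |D 2 a t|) := ?_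
    _ ≤ |ip r (fun t => |D 2 a t|)| := le_abs_self _
    _ ≤ l2norm r * l2norm (fun t => |D 2 a t|) := abs_ip_le hrL habs
    _ = _ := by rw [l2norm_abs]
  rw [ip, ip, hx.integral_eq_sum (intervalIntegrable_mul hE ha2.memLp_D),
    hx.integral_eq_sum (intervalIntegrable_mul hrL habs)]
  refine (Finset.abs_sum_le_sum_abs _ _).trans (Finset.sum_le_sum fun i hi => ?_)
  have hi := Finset.mem_range.1 hi
  have hle := (hx.lt i hi).le
  obtain ⟨e, ρ, he, hρ, hsum, horth, hb⟩ := h i hi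
  obtain ⟨q, hq, hqa⟩ := ha.2 i hi
  set R := derivative (derivative q) with hR
  have hD : ∀ t ∈ Ioo (x i) (x (i + 1)), D 2 a t = R.eval t := fun t ht =>
    eqOn_D_two_of_eqOn_Ioo (hx.Ioo_subset hi) hqa ht
  have hI : ∀ {f : ℝ → ℝ}, ContinuousOn f (Icc (x i) (x (i + 1))) →
      IntervalIntegrable f volume (x i) (x (i + 1)) :=
    fun hf => ContinuousOn.intervalIntegrable (by rwa [uIcc_of_le hle])
  have i1 : IntervalIntegrable (fun t => e t * R.eval t) volume (x i) (x (i + 1)) :=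
    hI (he.mul R.continuousOn)
  have i2 : IntervalIntegrable (fun t => ρ t * R.eval t) volume (x i) (x (i + 1)) :=
    hI (hρ.mul R.continuousOn)
  have i3 : IntervalIntegrable (fun t => r t * |R.eval t|) volume (x i) (x (i + 1)) :=
    hI ((hr.mono (hx.Icc_subset hi)).mul R.continuousOn.abs)
  -- On an element the second derivative of a spline is a polynomial of degree at most `p - 2`, so
  -- `e` disappears and only `ρ` is left.
  have e1 : ∫ t in x i..x (i + 1), E t * D 2 a t = ∫ t in x i..x (i + 1), ρ t * R.eval t := by
    rw [intervalIntegral.integral_congr_Ioo_of_le hle (g := fun t => e t * R.eval t + ρ t * R.eval t)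
      (fun t ht => by rw [hsum t ht, hD t ht, add_mul]), intervalIntegral.integral_add i1 i2,
      horth R (natDegree_derivative_derivative_le hq), zero_add]
  have e2 : ∫ t in x i..x (i + 1), r t * |D 2 a t| = ∫ t in x i..x (i + 1), r t * |R.eval t| :=
    intervalIntegral.integral_congr_Ioo_of_le hle fun t ht => by rw [hD t ht]
  rw [e1, e2]
  refine (intervalIntegral.abs_integral_le_integral_abs hle).trans ?_
  refine intervalIntegral.integral_mono_on_of_le_Ioo hle i2.abs i3 fun t ht => ?_
  rw [abs_mul]
  exact mul_le_mul_of_nonneg_right (hb t ht) (abs_nonneg _)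

/-- Approximation by a spline that is the local interpolant minus `q` on the elements in `Z` and
equals `q₂` on the others. -/
theorem exists_two_zone_approx {p N : ℕ} (hp : 3 ≤ p) {x : ℕ → ℝ} (hx : IsMesh N x)
    {g : ℕ → ℝ → ℝ} (hg : DerivChain (p + 1) g) (Z : ℕ → Prop) {q q₂ : ℝ[X]}
    (hq : q.natDegree ≤ p) (hq₂ : q₂.natDegree ≤ p) {G : ℕ → ℝ}
    (hG : ∀ i < N, Z i → ∀ t ∈ Icc (x i) (x (i + 1)), |g (p + 1) t| ≤ G i)
    (hm : ∀ i, i + 1 < N → (Z i ↔ ¬ Z (i + 1)) →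
      q.eval (x (i + 1)) + q₂.eval (x (i + 1)) = g 0 (x (i + 1)) ∧
      (derivative q).eval (x (i + 1)) + (derivative q₂).eval (x (i + 1)) = g 1 (x (i + 1)))
    (hend : ∀ i < N, ∀ ξ ∈ ({0, 1} : Set ℝ), ξ ∈ Icc (x i) (x (i + 1)) →
      (Z i → q.eval ξ = 0 ∧ (derivative q).eval ξ = 0) ∧
      (¬ Z i → q₂.eval ξ = g 0 ξ ∧ (derivative q₂).eval ξ = g 1 ξ)) :
    ∃ s, s ∈ Spline p 1 N x ∧ MemH 2 s ∧ Clamped (fun t => g 0 t - s t) ∧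
      (∀ i < N, Z i → ∀ t ∈ Icc (x i) (x (i + 1)),
        |g 0 t - s t - q.eval t| ≤ (x (i + 1) - x i) ^ (p + 1) * G i) ∧
      (∀ i < N, ¬ Z i → ∀ t ∈ Icc (x i) (x (i + 1)), s t = q₂.eval t) ∧
      (∀ i < N, Z i → ∫ t in x i..x (i + 1),
        (g 2 t - D 2 s t - (derivative (derivative q)).eval t) ^ 2 ≤
          (x (i + 1) - x i) * ((x (i + 1) - x i) ^ (p - 1) * G i) ^ 2) ∧
      ∀ r : ℝ → ℝ, ContinuousOn r (Icc 0 1) →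
        (∀ i < N, Z i → ∀ t ∈ Ioo (x i) (x (i + 1)),
          |(derivative (derivative q)).eval t| ≤ r t) →
        (∀ i < N, ¬ Z i → ∀ t ∈ Ioo (x i) (x (i + 1)),
          |g 2 t - (derivative (derivative q₂)).eval t| ≤ r t) →
        ∀ a ∈ Spline p 1 N x, MemH 2 a →
          |ip (D 2 fun t => g 0 t - s t) (D 2 a)| ≤ l2norm r * l2norm (D 2 a) := by
  classical
  have hloc : ∀ i, ∃ Q : ℝ[X], i < N ∧ Z i → _ := fun i => by
    by_cases h : i < N ∧ Z i
    · obtain ⟨Q, hQ⟩ := exists_local_interp hp (hx.lt i h.1) g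
        (fun k hk t ht => (hg k hk t (hx.Icc_subset h.1 ht)).mono (hx.Icc_subset h.1))
        (hG i h.1 h.2)
      exact ⟨Q, fun _ => hQ⟩
    · exact ⟨0, fun h' => absurd h' h⟩
  choose I hI using hloc
  set Q : ℕ → ℝ[X] := fun i => if Z i then I i - q else q₂ with hQ
  have hQZ : ∀ {i}, Z i → Q i = I i - q := fun h => if_pos h
  have hQn : ∀ {i}, ¬ Z i → Q i = q₂ := fun h => if_neg h
  obtain ⟨s, hs, hs2, hsQ⟩ := exists_glue (p := p) hx Q (fun i hi => by
      by_cases h : Z i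
      · rw [hQZ h]
        exact (natDegree_sub_le _ _).trans (max_le (hI i ⟨hi, h⟩).1 hq)
      · rwa [hQn h]) (fun i hi => by
      -- Inside either zone adjacent pieces agree automatically; only where the zone changes does
      -- the condition `q + q₂ = g` on values and slopes enter.
      have hm' := hm i hi
      by_cases h : Z i <;> by_cases h' : Z (i + 1)
      · obtain ⟨_, _, hb, _⟩ := hI i ⟨by omega, h⟩
        obtain ⟨_, ha, _⟩ := hI (i + 1) ⟨hi, h'⟩
        simp [hQZ h, hQZ h', ha, hb]
      · obtain ⟨_, _, hb, _⟩ := hI i ⟨by omega, h⟩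
        have := hm' (by tauto)
        simp only [hQZ h, hQn h', eval_sub, derivative_sub, hb]
        constructor <;> linarith [this.1, this.2]
      · obtain ⟨_, ha, _⟩ := hI (i + 1) ⟨hi, h'⟩
        have := hm' (by tauto)
        simp only [hQn h, hQZ h', eval_sub, derivative_sub, ha]
        constructor <;> linarith [this.1, this.2]
      · rw [hQn h, hQn h']; simp)
  have hg2 := hg.memH_two (by omega)
  have hsub := hg2.sub hs2
  have hDs : ∀ i < N, ∀ t ∈ Ioo (x i) (x (i + 1)),
      D 2 s t = (derivative (derivative (Q i))).eval t := fun i hi t ht =>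
    eqOn_D_two_of_eqOn_Ioo (hx.Ioo_subset hi)
      (fun t ht => (hsQ i hi t (Ioo_subset_Icc_self ht)).1) ht
  refine ⟨s, hs, hs2, fun ξ hξ => ?_, fun i hi h t ht => ?_, fun i hi h t ht => ?_,
    fun i hi h => ?_, fun r hr hr1 hr2 a ha ha2 => ?_⟩
  · have hm : ξ ∈ Icc (0 : ℝ) 1 := by rcases hξ with rfl | rfl <;> simp
    obtain ⟨i, hi, ht⟩ := hx.exists_mem_Icc hm
    rw [hsub.2.1 hm]
    simp only [hg.D_eqOn (k := 1) (by omega) hm, (hsQ i hi ξ ht).1, (hsQ i hi ξ ht).2]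
    have he := hend i hi ξ hξ ht
    by_cases h : Z i
    · obtain ⟨_, ha, hb, _⟩ := hI i ⟨hi, h⟩
      have hz := he.1 h
      -- An end point of `[0,1]` is a node of the element, and at nodes the local interpolant is
      -- exact.
      have hξ' : ξ = x i ∨ ξ = x (i + 1) := by
        have h0 := hx.mem_unit hi.le
        have h1 := hx.mem_unit (i := i + 1) hi
        rcases hξ with rfl | rfl
        · exact Or.inl (le_antisymm h0.1 ht.1)
        · exact Or.inr (le_antisymm ht.2 h1.2)
      rw [hQZ h, derivative_sub, eval_sub, eval_sub, hz.1, hz.2]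
      rcases hξ' with rfl | rfl
      · simp [ha]
      · simp [hb]
    · have hz := he.2 h
      rw [hQn h, hz.1, hz.2]
      simp
  · obtain ⟨_, _, _, _, hb, _⟩ := hI i ⟨hi, h⟩
    rw [(hsQ i hi t ht).1, hQZ h, eval_sub]
    convert hb t ht using 2
    ring
  · rw [(hsQ i hi t ht).1, hQn h]
  · obtain ⟨_, _, _, _, _, hb⟩ := hI i ⟨hi, h⟩
    refine le_trans (le_of_eq ?_) hb
    refine intervalIntegral.integral_congr_Ioo_of_le (hx.lt i hi).le fun t ht => ?_
    rw [hDs i hi t ht, hQZ h, derivative_sub, derivative_sub, eval_sub]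
    ring
  · have hE : D 2 (fun t => g 0 t - s t) =ᵐ[volΩ] fun t => g 2 t - D 2 s t := by
      filter_upwards [hsub.2.2, ae_mem_Ioo] with t h1 h2
      rw [h1, hg.D_eqOn (k := 2) (by omega) (Ioo_subset_Icc_self h2)]
    rw [ip_congr hE (Filter.EventuallyEq.refl _ _)]
    have hc2 := hg.continuousOn (k := 2) (by omega)
    refine abs_ip_le_of_piecewise hx ((memLp_of_continuousOn hc2).sub hs2.memLp_D) hr ha ha2
      fun i hi => ?_
    have hc2' := hc2.mono (hx.Icc_subset hi)
    by_cases h : Z i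
    · obtain ⟨_, _, _, ho, _⟩ := hI i ⟨hi, h⟩
      refine ⟨_, _, hc2'.sub (derivative (derivative (I i))).continuousOn,
        (derivative (derivative q)).continuousOn, fun t ht => ?_, ho, hr1 i hi h⟩
      rw [hDs i hi t ht, hQZ h, derivative_sub, derivative_sub, eval_sub, Pi.sub_apply]
      ring
    · refine ⟨fun _ => 0, _, continuousOn_const,
        hc2'.sub (derivative (derivative q₂)).continuousOn, fun t ht => ?_, by simp,
        hr2 i hi h⟩
      rw [hDs i hi t ht, hQn h, Pi.sub_apply]
      ring

/-- A single zone with `q = 0`: the spline is the projection interpolant on every element. The exact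
orthogonality is what removes the regular component from the pairings of second derivatives. -/
theorem exists_regular_approx {p N : ℕ} (hp : 3 ≤ p) {x : ℕ → ℝ} (hx : IsMesh N x) {H : ℝ}
    (hH : ∀ i < N, x (i + 1) - x i ≤ H) {g : ℕ → ℝ → ℝ} (hg : DerivChain (p + 1) g) {M : ℝ}
    (hM : ∀ t ∈ Icc (0 : ℝ) 1, |g (p + 1) t| ≤ M) :
    ∃ s, s ∈ Spline p 1 N x ∧ MemH 2 s ∧ Clamped (fun t => g 0 t - s t) ∧
      l2norm (fun t => g 0 t - s t) ≤ H ^ (p + 1) * M ∧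
      l2norm (D 2 fun t => g 0 t - s t) ≤ H ^ (p - 1) * M ∧
      ∀ a ∈ Spline p 1 N x, MemH 2 a → ip (D 2 fun t => g 0 t - s t) (D 2 a) = 0 := by
  have hM0 : 0 ≤ M := (abs_nonneg _).trans (hM 0 (by simp))
  have hH0 : 0 ≤ H := (sub_nonneg.2 (hx.lt 0 hx.pos).le).trans (hH 0 hx.pos)
  obtain ⟨s, hs, hs2, hcl, h1, -, h3, h4⟩ := exists_two_zone_approx hp hx hg (fun _ => True)
    (q := 0) (q₂ := 0) (G := fun _ => M) (by simp) (by simp)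
    (fun i hi _ t ht => hM t (hx.Icc_subset hi ht)) (by simp) (by simp)
  have hg2 := hg.memH_two (by omega)
  have hpow : ∀ k, ∀ i < N, (x (i + 1) - x i) ^ k * M ≤ H ^ k * M := fun k i hi =>
    mul_le_mul_of_nonneg_right
      (pow_le_pow_left₀ (sub_nonneg.2 (hx.lt i hi).le) (hH i hi) k) hM0
  refine ⟨s, hs, hs2, hcl, ?_, ?_, fun a ha ha2 => ?_⟩
  · have := l2norm_le_of_ae_abs_le (w := fun t => g 0 t - s t) (g := fun _ => 1) (K := 1)
      (c := H ^ (p + 1) * M) (by positivity) (memLp_const 1) ?_ (by simp [ip]) zero_le_one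
    · simpa using this
    · filter_upwards [ae_mem_Ioo] with t ht
      obtain ⟨i, hi, ht⟩ := hx.exists_mem_Icc (Ioo_subset_Icc_self ht)
      have := h1 i hi trivial t ht
      simp only [eval_zero, sub_zero] at this
      simpa using this.trans (hpow _ i hi)
  · have hE : D 2 (fun t => g 0 t - s t) =ᵐ[volΩ] fun t => g 2 t - D 2 s t := by
      filter_upwards [(hg2.sub hs2).2.2, ae_mem_Ioo] with t h1 h2
      rw [h1, hg.D_eqOn (k := 2) (by omega) (Ioo_subset_Icc_self h2)]
    have hL : MemLp (fun t => g 2 t - D 2 s t) 2 volΩ :=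
      (memLp_of_continuousOn (hg.continuousOn (k := 2) (by omega))).sub hs2.memLp_D
    rw [l2norm_congr hE]
    refine Real.sqrt_le_iff.2 ⟨by positivity, ?_⟩
    rw [ip, hx.integral_eq_sum (intervalIntegrable_mul hL hL)]
    calc _ ≤ ∑ i ∈ Finset.range N, (x (i + 1) - x i) * (H ^ (p - 1) * M) ^ 2 := ?_
      _ = _ := by rw [← Finset.sum_mul, Finset.sum_range_sub, hx.zero, hx.one]; ring
    refine Finset.sum_le_sum fun i hi => ?_
    have hi := Finset.mem_range.1 hi
    have h := h3 i hi trivial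
    have h0 : 0 ≤ x (i + 1) - x i := sub_nonneg.2 (hx.lt i hi).le
    simp only [derivative_zero, eval_zero, sub_zero] at h
    simp only [← pow_two]
    refine h.trans (mul_le_mul_of_nonneg_left ?_ h0)
    exact pow_le_pow_left₀ (by positivity) (hpow _ i hi) 2
  · have h := h4 (fun _ => 0) continuousOn_const (by simp) (by simp) a ha ha2
    have h0 : l2norm (fun _ => 0) = 0 := by simp [l2norm, ip]
    rw [h0, zero_mul] at h
    exact abs_eq_zero.1 (le_antisymm h (abs_nonneg _))

/-! ### Approximation of the boundary layers. -/

/-- The cubic with vanishing Hermite data at `y = y₀` and prescribed data at `y = y₀ + l`, in the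
coordinate `y = c + s t`. -/
theorem exists_cubic (c s y₀ A B : ℝ) {l : ℝ} (hl : 0 < l) (hs : s ^ 2 = 1) :
    ∃ q : ℝ[X], q.natDegree ≤ 3 ∧
      (∀ t, c + s * t = y₀ → q.eval t = 0 ∧ (derivative q).eval t = 0) ∧
      (∀ t, c + s * t = y₀ + l → q.eval t = A ∧ (derivative q).eval t = s * B) ∧
      ∀ t, y₀ ≤ c + s * t → c + s * t ≤ y₀ + l → |q.eval t| ≤ |A| + l * |B| ∧
        |(derivative (derivative q)).eval t| ≤ 6 * |A| / l ^ 2 + 4 * |B| / l := by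
  set Θ : ℝ[X] := C (s / l) * X + C ((c - y₀) / l) with hΘ
  have hΘd : Θ.natDegree ≤ 1 := natDegree_linear_le
  have hΘ' : derivative Θ = C (s / l) := by simp [hΘ]
  have hΘe : ∀ t, Θ.eval t = (c + s * t - y₀) / l := fun t => by
    simp only [hΘ, eval_add, eval_mul, eval_C, eval_X]; ring
  -- The Hermite cubic in the reference coordinate `Θ = (y - y₀)/l`, with a double zero at `Θ = 0`.
  -- `B` is the slope in `y`, hence `s * B` is the slope in `t`.
  set q : ℝ[X] := C (l * B - 2 * A) * Θ ^ 3 + C (3 * A - l * B) * Θ ^ 2 with hq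
  have e0 : ∀ t, q.eval t = (l * B - 2 * A) * Θ.eval t ^ 3 + (3 * A - l * B) * Θ.eval t ^ 2 :=
    fun t => by simp [hq]
  have hq' : derivative q = C (3 * (l * B - 2 * A) * (s / l)) * Θ ^ 2 +
      C (2 * (3 * A - l * B) * (s / l)) * Θ := by
    simp only [hq, derivative_add, derivative_C_mul, derivative_pow, hΘ', map_mul]
    simp
    ring
  have e2 : ∀ t, (derivative (derivative q)).eval t =
      6 * (l * B - 2 * A) * (s / l) ^ 2 * Θ.eval t + 2 * (3 * A - l * B) * (s / l) ^ 2 := fun t => by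
    rw [hq', derivative_add, derivative_C_mul, derivative_C_mul, derivative_pow, hΘ']
    simp
    ring
  have hsl : (s / l) ^ 2 = 1 / l ^ 2 := by rw [div_pow, hs]
  refine ⟨q, ?_, fun t ht => ?_, fun t ht => ?_, fun t h0 h1 => ?_⟩
  · refine natDegree_add_le_of_degree_le ?_ ?_
    · exact (natDegree_C_mul_le _ _).trans ((natDegree_pow_le_of_le 3 hΘd).trans (by norm_num))
    · exact (natDegree_C_mul_le _ _).trans ((natDegree_pow_le_of_le 2 hΘd).trans (by norm_num))
  · have : Θ.eval t = 0 := by rw [hΘe, ht, sub_self, zero_div]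
    simp [e0, hq', this]
  · have : Θ.eval t = 1 := by rw [hΘe, ht, add_sub_cancel_left, div_self hl.ne']
    simp only [e0, hq', this, eval_add, eval_mul, eval_C, eval_pow]
    constructor
    · ring
    · field_simp
      ring
  · set θ := Θ.eval t with hθ
    have hθ0 : 0 ≤ θ := by rw [hθ, hΘe]; exact div_nonneg (by linarith) hl.le
    have hθ1 : θ ≤ 1 := by rw [hθ, hΘe, div_le_one hl]; linarith
    have key : ∀ u v a b : ℝ, |u| ≤ a → |v| ≤ b → |u * A + v * B| ≤ a * |A| + b * |B| :=
      fun u v a b hu hv => (abs_add_le _ _).trans (by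
        rw [abs_mul, abs_mul]
        exact add_le_add (mul_le_mul_of_nonneg_right hu (abs_nonneg _))
          (mul_le_mul_of_nonneg_right hv (abs_nonneg _)))
    constructor
    · rw [e0, ← one_mul |A|]
      have := key (θ ^ 2 * (3 - 2 * θ)) (l * (θ ^ 2 * (θ - 1))) 1 l ?_ ?_
      · convert this using 2
        ring
      · rw [abs_le]
        constructor <;> nlinarith [sq_nonneg θ, sq_nonneg (θ - 1), mul_nonneg hθ0 (sq_nonneg θ)]
      · rw [abs_mul, abs_of_pos hl]
        refine mul_le_of_le_one_right hl.le ?_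
        rw [abs_le]
        constructor <;> nlinarith [sq_nonneg θ, sq_nonneg (θ - 1)]
    · have := key ((6 - 12 * θ) / l ^ 2) ((6 * θ - 2) / l) (6 / l ^ 2) (4 / l) ?_ ?_
      · rw [e2, hsl, ← hθ]
        convert this using 2 <;> field_simp
        ring
      · rw [abs_div, abs_of_pos (by positivity : 0 < l ^ 2)]
        gcongr
        rw [abs_le]
        constructor <;> linarith
      · rw [abs_div, abs_of_pos hl]
        gcongr
        rw [abs_le]
        constructor <;> linarith

theorem integral_exp_sq_le {c s δ : ℝ} (hδ : 0 < δ) (hcs : (c = 0 ∧ s = 1) ∨ (c = 1 ∧ s = -1)) :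
    ∫ t in (0 : ℝ)..1, Real.exp (-(c + s * t) / δ) ^ 2 ≤ δ / 2 := by
  have hs : s ≠ 0 := by rcases hcs with ⟨_, rfl⟩ | ⟨_, rfl⟩ <;> norm_num
  have hd : ∀ t ∈ uIcc (0 : ℝ) 1, HasDerivAt
      (fun t => -(δ / (2 * s)) * Real.exp (-(c + s * t) / δ) ^ 2)
      (Real.exp (-(c + s * t) / δ) ^ 2) t := fun t _ => by
    have h := (((((hasDerivAt_id t).const_mul s).const_add c).neg.div_const δ).exp.pow 2).const_mul
      (-(δ / (2 * s)))
    refine h.congr_deriv ?_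
    simp
    field_simp
  rw [intervalIntegral.integral_eq_sub_of_hasDerivAt hd
    (Continuous.intervalIntegrable (by fun_prop) _ _)]
  rcases hcs with ⟨rfl, rfl⟩ | ⟨rfl, rfl⟩ <;> norm_num <;> ring_nf <;>
    nlinarith [sq_nonneg (Real.exp (-δ⁻¹)), sq_nonneg (Real.exp (δ⁻¹ * -1))]

theorem one_le_log_nat {N : ℕ} (hN : 4 ≤ N) : 1 ≤ Real.log N := by
  have h1 : Real.log 4 ≤ Real.log N := Real.log_le_log (by norm_num) (by exact_mod_cast hN)
  have h2 : Real.log 4 = 2 * Real.log 2 := by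
    rw [show (4 : ℝ) = 2 ^ 2 by norm_num, Real.log_pow]; norm_num
  linarith [Real.log_two_gt_d9]

theorem exp_neg_mul_log_le {p N : ℕ} (hN : 4 ≤ N) {σ : ℝ} (hσ : (p : ℝ) + 1 ≤ σ) :
    Real.exp (-(σ * Real.log N)) ≤ ((N : ℝ) ^ (p + 1))⁻¹ := by
  have hN0 : (0 : ℝ) < N := by exact_mod_cast (by omega : 0 < N)
  have : ((N : ℝ) ^ (p + 1))⁻¹ = Real.exp (-((p + 1 : ℝ) * Real.log N)) := by
    rw [Real.exp_neg, mul_comm, Real.exp_mul, Real.exp_log hN0]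
    norm_cast
  rw [this]
  have := one_le_log_nat hN
  gcongr

/-- At the transition point the layer is at most `N^{-(p+1)}`, since `σ ≥ p+1`. The target `(ln N /
N)^{p+1}` leaves spare logarithms: one pays for the factor `τ/ε` in the cubic, one for the `(ln
N)⁻¹` in the weight. -/
theorem exp_transition_mul_log_le {p N : ℕ} (hp : 3 ≤ p) (hN : 4 ≤ N) {σ : ℝ}
    (hσ : (p : ℝ) + 1 ≤ σ) :
    Real.exp (-(σ * Real.log N)) * Real.log N ≤
      (Real.log N / N) ^ (p + 1) * (Real.log N)⁻¹ := by
  have hL := one_le_log_nat hN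
  set L := Real.log N
  have h := exp_neg_mul_log_le hN hσ
  have hN0 : (0 : ℝ) < N := by exact_mod_cast (by omega : 0 < N)
  calc Real.exp (-(σ * L)) * L ≤ ((N : ℝ) ^ (p + 1))⁻¹ * L := by gcongr
    _ ≤ ((N : ℝ) ^ (p + 1))⁻¹ * L ^ p := by
        gcongr
        exact le_self_pow₀ hL (by omega)
    _ = _ := by
        rw [div_pow]
        field_simp
        ring

theorem one_le_three_mul_exp {y τ : ℝ} (hτ : 0 < τ) (hy : y ≤ τ) :
    1 ≤ 3 * Real.exp (-y / τ) := by
  have h1 : Real.exp (-1) ≤ Real.exp (-y / τ) := by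
    apply Real.exp_le_exp.2
    rw [le_div_iff₀ hτ]
    linarith
  have h2 : Real.exp 1 * Real.exp (-1) = 1 := by rw [← Real.exp_add]; simp
  have h3 := Real.exp_one_lt_d9
  nlinarith [Real.exp_pos (-1)]

/-- Beyond `τ` part of the decay is spent on the small factor `exp(-τ/ε)`; the rest is weakened to
the scale `τ`, at the cost of a factor `e < 3`. The retained decay later yields the factor `√ε` in
`L₂`. -/
theorem exp_le_of_transition_le {y τ ε : ℝ} (hε : 0 < ε) (hετ : ε ≤ τ) (hy : τ ≤ y) :
    Real.exp (-y / ε) ≤ 3 * (Real.exp (-τ / ε) * Real.exp (-y / τ)) := by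
  have hτ : 0 < τ := hε.trans_le hετ
  have h1 : Real.exp (-y / ε) ≤ Real.exp 1 * (Real.exp (-τ / ε) * Real.exp (-y / τ)) := by
    rw [← Real.exp_add, ← Real.exp_add]
    apply Real.exp_le_exp.2
    have : (y - τ) / τ ≤ (y - τ) / ε := by
      gcongr
    have e1 : (y - τ) / τ = y / τ - 1 := by rw [sub_div, div_self hτ.ne']
    have e2 : (y - τ) / ε = y / ε - τ / ε := sub_div _ _ _
    rw [e1, e2] at this
    rw [neg_div, neg_div, neg_div]
    linarith
  have h3 := Real.exp_one_lt_d9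
  exact h1.trans (mul_le_mul_of_nonneg_right (by linarith) (by positivity))

/-- Bounds the Hermite data of a layer at the far end. With `z = 1/ε`, half of the exponent absorbs
`1 + z`, and `τ/ε` and `y/τ` take at most a quarter each. -/
theorem exp_neg_inv_mul_le {y τ ε : ℝ} (hε : 0 < ε) (hετ : 4 * ε ≤ τ) (hτ : τ ≤ 1 / 4)
    (hy : y ≤ 1) : Real.exp (-1 / ε) * (1 + 1 / ε) ≤
      2 * (Real.exp (-τ / ε) * Real.exp (-y / τ)) := by
  have hτ0 : 0 < τ := by linarith
  set z := 1 / ε with hz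
  have hz0 : 0 < z := by positivity
  have h1 : 1 + z ≤ 2 * Real.exp (z / 2) := by linarith [Real.add_one_le_exp (z / 2)]
  have h2 : Real.exp (-1 / ε) * Real.exp (z / 2) ≤ Real.exp (-τ / ε) * Real.exp (-y / τ) := by
    rw [← Real.exp_add, ← Real.exp_add]
    apply Real.exp_le_exp.2
    have a1 : τ / ε ≤ z / 4 := by
      rw [hz, div_div, div_le_div_iff₀ hε (by positivity)]
      nlinarith
    have a2 : y / τ ≤ z / 4 := by
      rw [hz, div_div, div_le_div_iff₀ hτ0 (by positivity)]
      nlinarith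
    have a3 : (-1) / ε = -z := by rw [hz, neg_div]
    rw [a3, neg_div, neg_div]
    linarith
  calc Real.exp (-1 / ε) * (1 + z) ≤ Real.exp (-1 / ε) * (2 * Real.exp (z / 2)) := by gcongr
    _ = 2 * (Real.exp (-1 / ε) * Real.exp (z / 2)) := by ring
    _ ≤ _ := by gcongr

section

variable {p N : ℕ} {σ ε M c s : ℝ} {x : ℕ → ℝ} {g : ℕ → ℝ → ℝ}

set_option maxHeartbeats 400000 in
/-- Pieces of the layer approximation when the transition point is `σ ε ln N < 1/4`. -/
theorem exists_layer_cubics (hp : 3 ≤ p) (hσ : (p : ℝ) + 1 ≤ σ) (hε : 0 < ε) (hε1 : ε ≤ 1)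
    (hN : 4 ≤ N) (hcs : (c = 0 ∧ s = 1) ∨ (c = 1 ∧ s = -1))
    (hb : ∀ k ≤ p + 1, ∀ t ∈ Icc (0 : ℝ) 1,
      |g k t| ≤ M * ((ε ^ k)⁻¹ * Real.exp (-(c + s * t) / ε)))
    {τ : ℝ} (hτ : τ = σ * ε * Real.log N) (hτ4 : τ < 1 / 4) :
    ∃ q q₂ : ℝ[X], q.natDegree ≤ 3 ∧ q₂.natDegree ≤ 3 ∧
      (∀ t, c + s * t = 0 → q.eval t = 0 ∧ (derivative q).eval t = 0) ∧
      (∀ t, c + s * t = τ → q.eval t + q₂.eval t = g 0 t ∧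
        (derivative q).eval t + (derivative q₂).eval t = g 1 t) ∧
      (∀ t, c + s * t = 1 → q₂.eval t = g 0 t ∧ (derivative q₂).eval t = g 1 t) ∧
      (∀ t, 0 ≤ c + s * t → c + s * t ≤ τ →
        |q.eval t| ≤ 30 * (1 + σ) * M * ((Real.log N / N) ^ (p + 1) *
          ((Real.log N)⁻¹ * Real.exp (-(c + s * t) / τ))) ∧
        |(derivative (derivative q)).eval t| ≤ 30 * (1 + σ) * M * ((Real.log N / N) ^ (p + 1) *
          ((Real.log N)⁻¹ * Real.exp (-(c + s * t) / τ))) * (ε ^ 2)⁻¹) ∧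
      ∀ t ∈ Icc (0 : ℝ) 1, τ ≤ c + s * t → c + s * t ≤ 1 →
        |g 0 t - q₂.eval t| ≤ 30 * (1 + σ) * M * ((Real.log N / N) ^ (p + 1) *
          ((Real.log N)⁻¹ * Real.exp (-(c + s * t) / τ))) ∧
        |g 2 t - (derivative (derivative q₂)).eval t| ≤ 30 * (1 + σ) * M *
          ((Real.log N / N) ^ (p + 1) *
          ((Real.log N)⁻¹ * Real.exp (-(c + s * t) / τ))) * (ε ^ 2)⁻¹ := by
  have hL := one_le_log_nat hN
  have hW := exp_transition_mul_log_le hp hN hσ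
  set L := Real.log N with hLdef
  set Λ := (L / N) ^ (p + 1) with hΛ
  have hp' : (3 : ℝ) ≤ p := by exact_mod_cast hp
  have hσ4 : 4 ≤ σ := by linarith
  have hσL : 4 ≤ σ * L := by nlinarith
  have hετ : 4 * ε ≤ τ := by rw [hτ]; nlinarith
  have hτ0 : 0 < τ := by linarith
  have hτε : τ / ε = σ * L := by rw [hτ]; field_simp
  set eτ := Real.exp (-τ / ε) with heτ
  have hW' : eτ * L ≤ Λ * L⁻¹ := by rwa [heτ, neg_div, hτε]
  have heτ0 : 0 < eτ := Real.exp_pos _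
  have hM : 0 ≤ M := by
    have := (abs_nonneg _).trans (hb 0 (by omega) 0 (by simp))
    exact nonneg_of_mul_nonneg_left this (by positivity)
  have hs2 : s ^ 2 = 1 := by rcases hcs with ⟨-, rfl⟩ | ⟨-, rfl⟩ <;> norm_num
  have hs2' : s * s = 1 := by rw [← pow_two, hs2]
  have hmem : ∀ y, 0 ≤ y → y ≤ 1 → s * (y - c) ∈ Icc (0 : ℝ) 1 := fun y h0 h1 => by
    rcases hcs with ⟨rfl, rfl⟩ | ⟨rfl, rfl⟩ <;> constructor <;> linarith
  have hinv : ∀ y, c + s * (s * (y - c)) = y := fun y => by rw [← mul_assoc, hs2']; ring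
  have huniq : ∀ t y, c + s * t = y → t = s * (y - c) := fun t y h => by
    rw [← h, add_sub_cancel_left, ← mul_assoc, hs2', one_mul]
  have hlen : 0 < 1 - τ := by linarith
  set xτ := s * (τ - c) with hxτ
  set x1 := s * (1 - c) with hx1
  have hmτ := hmem τ hτ0.le (by linarith)
  have hm1 := hmem 1 zero_le_one le_rfl
  -- `q` lives on `0 ≤ y ≤ τ` and carries the data of the layer at `τ`; `q₂` lives on `τ ≤ y ≤ 1`
  -- and carries those at `y = 1`. Both have zero data at their other end.
  obtain ⟨q, hq, hq0, hqτ, hqb⟩ := exists_cubic c s 0 (g 0 xτ) (s * g 1 xτ) hτ0 hs2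
  obtain ⟨q₂, hq₂, hq₂0, hq₂τ, hq₂b⟩ := exists_cubic c s τ (g 0 x1) (s * g 1 x1) hlen hs2
  have habs_s : |s| = 1 := by rcases hcs with ⟨-, rfl⟩ | ⟨-, rfl⟩ <;> norm_num
  have bA : |g 0 xτ| ≤ M * eτ := by
    have := hb 0 (by omega) xτ hmτ
    rwa [hinv, pow_zero, inv_one, one_mul] at this
  have bB : |s * g 1 xτ| ≤ M * eτ / ε := by
    have := hb 1 (by omega) xτ hmτ
    rw [hinv, pow_one] at this
    rw [abs_mul, habs_s, one_mul]
    exact this.trans (le_of_eq (by ring))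
  set e1 := Real.exp (-1 / ε) with he1
  have he10 : 0 < e1 := Real.exp_pos _
  have bA1 : |g 0 x1| ≤ M * e1 := by
    have := hb 0 (by omega) x1 hm1
    rwa [hinv, pow_zero, inv_one, one_mul] at this
  have bB1 : |s * g 1 x1| ≤ M * e1 / ε := by
    have := hb 1 (by omega) x1 hm1
    rw [hinv, pow_one] at this
    rw [abs_mul, habs_s, one_mul]
    exact this.trans (le_of_eq (by ring))
  have hε2 : 1 ≤ (ε ^ 2)⁻¹ := (one_le_inv₀ (by positivity)).2 (pow_le_one₀ hε.le hε1)
  refine ⟨q, q₂, hq, hq₂, fun t ht => hq0 t ht, fun t ht => ?_, fun t ht => ?_,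
    fun t h0 h1 => ?_, fun t ht h0 h1 => ?_⟩
  · have e1 := hqτ t (by rw [ht, zero_add])
    have e2 := hq₂0 t ht
    rw [e1.1, e1.2, e2.1, e2.2, huniq t τ ht, ← mul_assoc, hs2']
    simp [hxτ]
  · have e1 := hq₂τ t (by rw [ht]; ring)
    rw [e1.1, e1.2, huniq t 1 ht, ← mul_assoc, hs2', one_mul]
    exact ⟨rfl, rfl⟩
  · obtain ⟨b0, b2⟩ := hqb t h0 (by rwa [zero_add])
    have h3 := one_le_three_mul_exp hτ0 h1
    set w := Real.exp (-(c + s * t) / τ) with hw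
    -- For `y ≤ τ` the weight `w` is at least `1/3`, so it can be inserted for free.
    have hX : eτ * L ≤ 3 * (Λ * (L⁻¹ * w)) := by
      refine hW'.trans ?_
      have : 0 ≤ Λ * L⁻¹ := by positivity
      nlinarith
    have hX' : eτ ≤ 3 * (Λ * (L⁻¹ * w)) := (le_mul_of_one_le_right heτ0.le hL).trans hX
    have hΛw : 0 ≤ Λ * (L⁻¹ * w) := by positivity
    constructor
    · calc |q.eval t| ≤ M * eτ + τ * (M * eτ / ε) := b0.trans (by gcongr)
        _ = M * (eτ + eτ * L * σ) := by
            rw [show τ * (M * eτ / ε) = M * eτ * (τ / ε) by ring, hτε]; ring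
        _ ≤ M * (3 * (Λ * (L⁻¹ * w)) + 3 * (Λ * (L⁻¹ * w)) * σ) := by gcongr
        _ = (3 * (1 + σ)) * (M * (Λ * (L⁻¹ * w))) := by ring
        _ ≤ (30 * (1 + σ)) * (M * (Λ * (L⁻¹ * w))) := by gcongr; norm_num
        _ = _ := by ring
    · have hτ2 : ε ≤ τ := by linarith
      calc _ ≤ 6 * (M * eτ) / τ ^ 2 + 4 * (M * eτ / ε) / τ := b2.trans (by gcongr)
        _ ≤ 6 * (M * eτ) / ε ^ 2 + 4 * (M * eτ / ε) / ε := by gcongr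
        _ = 10 * M * eτ * (ε ^ 2)⁻¹ := by field_simp; ring
        _ ≤ 10 * M * (3 * (Λ * (L⁻¹ * w))) * (ε ^ 2)⁻¹ := by gcongr
        _ = 30 * 1 * M * (Λ * (L⁻¹ * w)) * (ε ^ 2)⁻¹ := by ring
        _ ≤ _ := by gcongr; linarith
  · obtain ⟨b0, b2⟩ := hq₂b t h0 (by linarith)
    have h3 := exp_le_of_transition_le hε (by linarith) h0
    have h4 := exp_neg_inv_mul_le hε hετ hτ4.le h1
    set w := Real.exp (-(c + s * t) / τ) with hw
    have hw0 : 0 < w := Real.exp_pos _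
    have hX : eτ * w ≤ Λ * (L⁻¹ * w) := by
      rw [← mul_assoc]
      gcongr
      exact (le_mul_of_one_le_right heτ0.le hL).trans hW'
    have hΛw : 0 ≤ Λ * (L⁻¹ * w) := by positivity
    have g0 := hb 0 (by omega) t ht
    have g2 := hb 2 (by omega) t ht
    rw [pow_zero, inv_one, one_mul] at g0
    have hτ1 : 1 - τ ≤ 1 := by linarith
    have hτ34 : 3 / 4 ≤ 1 - τ := by linarith
    have k5 : 5 ≤ 30 * (1 + σ) := by linarith
    have k25 : 25 ≤ 30 * (1 + σ) := by linarith
    constructor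
    · calc _ ≤ |g 0 t| + |q₂.eval t| := abs_sub _ _
        _ ≤ M * (3 * (eτ * w)) + (M * e1 + 1 * (M * e1 / ε)) := by
            refine add_le_add (g0.trans (mul_le_mul_of_nonneg_left h3 hM)) (b0.trans ?_)
            exact add_le_add bA1 (mul_le_mul hτ1 bB1 (abs_nonneg _) zero_le_one)
        _ = M * (3 * (eτ * w)) + M * (e1 * (1 + 1 / ε)) := by ring
        _ ≤ M * (3 * (eτ * w)) + M * (2 * (eτ * w)) := by gcongr
        _ = 5 * M * (eτ * w) := by ring
        _ ≤ 30 * (1 + σ) * M * (Λ * (L⁻¹ * w)) := by gcongr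
    · calc _ ≤ |g 2 t| + |(derivative (derivative q₂)).eval t| := abs_sub _ _
        _ ≤ M * ((ε ^ 2)⁻¹ * (3 * (eτ * w))) +
            (6 * (M * e1) / (3 / 4) ^ 2 + 4 * (M * e1 / ε) / (3 / 4)) := by
            refine add_le_add (g2.trans (mul_le_mul_of_nonneg_left
              (mul_le_mul_of_nonneg_left h3 (by positivity)) hM)) (b2.trans ?_)
            gcongr
        -- Both `6/(3/4)²` and `4/(3/4)` are below `11`.
        _ ≤ M * ((ε ^ 2)⁻¹ * (3 * (eτ * w))) + 11 * M * (e1 * (1 + 1 / ε)) := by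
            have a1 : 0 ≤ M * e1 := by positivity
            have a2 : 0 ≤ M * e1 / ε := by positivity
            have a3 : 11 * M * (e1 * (1 + 1 / ε)) = 11 * (M * e1) + 11 * (M * e1 / ε) := by ring
            rw [a3]
            norm_num
            linarith
        _ ≤ M * ((ε ^ 2)⁻¹ * (3 * (eτ * w))) + 11 * M * (2 * (eτ * w)) * (ε ^ 2)⁻¹ := by
            have : 11 * M * (e1 * (1 + 1 / ε)) ≤ 11 * M * (2 * (eτ * w)) := by gcongr
            have h5 : 0 ≤ 11 * M * (2 * (eτ * w)) := by positivity
            nlinarith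
        _ = 25 * M * (eτ * w) * (ε ^ 2)⁻¹ := by ring
        _ ≤ 30 * (1 + σ) * M * (Λ * (L⁻¹ * w)) * (ε ^ 2)⁻¹ := by gcongr

end

/-- The weight `exp(-y/ε) + (ln N)⁻¹ exp(-y/τ)`, `y = c + s t`, that dominates the layer errors. -/
noncomputable def layerWeight (ε τ L c s t : ℝ) : ℝ :=
  Real.exp (-(c + s * t) / ε) + L⁻¹ * Real.exp (-(c + s * t) / τ)

theorem continuous_layerWeight (ε τ L c s : ℝ) : Continuous (layerWeight ε τ L c s) := by
  unfold layerWeight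
  fun_prop

/-- The wider exponential has squared norm of order `τ ≤ σ ε L`, but its coefficient `L⁻¹` removes
the logarithm, so the whole weight has norm of order `√ε`. -/
theorem ip_layerWeight_le {ε τ L c s σ : ℝ} (hε : 0 < ε) (hτ : 0 < τ) (hL : 1 ≤ L)
    (hσ : 0 ≤ σ) (hτL : τ ≤ σ * ε * L) (hcs : (c = 0 ∧ s = 1) ∨ (c = 1 ∧ s = -1)) :
    ip (layerWeight ε τ L c s) (layerWeight ε τ L c s) ≤ (Real.sqrt ε * (1 + σ)) ^ 2 := by
  have h1 := integral_exp_sq_le hε hcs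
  have h2 := integral_exp_sq_le hτ hcs
  have c1 : Continuous fun t => 2 * Real.exp (-(c + s * t) / ε) ^ 2 := by fun_prop
  have c2 : Continuous fun t => 2 * (L⁻¹) ^ 2 * Real.exp (-(c + s * t) / τ) ^ 2 := by fun_prop
  have hcw := continuous_layerWeight ε τ L c s
  calc ip (layerWeight ε τ L c s) (layerWeight ε τ L c s)
      ≤ ∫ t in (0 : ℝ)..1, (2 * Real.exp (-(c + s * t) / ε) ^ 2 +
          2 * (L⁻¹) ^ 2 * Real.exp (-(c + s * t) / τ) ^ 2) := by
        refine intervalIntegral.integral_mono_on zero_le_one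
          ((hcw.mul hcw).intervalIntegrable _ _) ((c1.add c2).intervalIntegrable _ _)
          fun t _ => ?_
        unfold layerWeight
        nlinarith [sq_nonneg (Real.exp (-(c + s * t) / ε) - L⁻¹ * Real.exp (-(c + s * t) / τ))]
    _ ≤ 2 * (ε / 2) + 2 * (L⁻¹) ^ 2 * (τ / 2) := by
        rw [intervalIntegral.integral_add (c1.intervalIntegrable _ _) (c2.intervalIntegrable _ _),
          intervalIntegral.integral_const_mul, intervalIntegral.integral_const_mul]
        gcongr
    _ ≤ 2 * (ε / 2) + 2 * (L⁻¹) ^ 2 * (σ * ε * L / 2) := by gcongr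
    _ = ε + σ * ε * L⁻¹ := by field_simp
    _ ≤ ε + σ * ε * 1 := by
        gcongr
        exact inv_le_one_of_one_le₀ hL
    _ ≤ ε * (1 + σ) ^ 2 := by nlinarith [mul_nonneg hσ hε.le, mul_nonneg (mul_nonneg hσ hσ) hε.le]
    _ = _ := by rw [mul_pow, Real.sq_sqrt hε.le]

theorem exp_coord_le {ε μ c s a b t t' : ℝ} (hε : 0 < ε)
    (hcs : (c = 0 ∧ s = 1) ∨ (c = 1 ∧ s = -1)) (hab : b - a ≤ μ * ε) (ht : t ∈ Icc a b)
    (ht' : t' ∈ Icc a b) :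
    Real.exp (-(c + s * t) / ε) ≤ Real.exp μ * Real.exp (-(c + s * t') / ε) := by
  rw [← Real.exp_add]
  apply Real.exp_le_exp.2
  rw [div_le_iff₀ hε, add_mul, div_mul_cancel₀ _ hε.ne']
  rcases hcs with ⟨rfl, rfl⟩ | ⟨rfl, rfl⟩ <;> linarith [ht.1, ht.2, ht'.1, ht'.2]

/-- `y = c + s t` is the distance to the end point of the layer, which treats both layers at once,
and `Z` marks the elements with `y ≤ τ`. All errors are bounded pointwise by `layerWeight`, whose
norm supplies `√ε`. -/
theorem exists_layer_approx {p : ℕ} (hp : 3 ≤ p) {σ : ℝ} (hσ : (p : ℝ) + 1 ≤ σ) :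
    ∃ K : ℝ, 0 < K ∧ ∀ {ε M c s τ : ℝ} {N : ℕ} {x : ℕ → ℝ} {g : ℕ → ℝ → ℝ} (Z : ℕ → Prop),
      0 < ε → ε ≤ 1 → 4 ≤ N → ((c = 0 ∧ s = 1) ∨ (c = 1 ∧ s = -1)) → IsMesh N x →
      DerivChain (p + 1) g →
      (∀ k ≤ p + 1, ∀ t ∈ Icc (0 : ℝ) 1,
        |g k t| ≤ M * ((ε ^ k)⁻¹ * Real.exp (-(c + s * t) / ε))) →
      τ = min (1 / 4) (σ * ε * Real.log N) →
      (∀ i < N, Z i → ∀ t ∈ Icc (x i) (x (i + 1)), c + s * t ≤ τ) →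
      (∀ i < N, ¬ Z i → ∀ t ∈ Icc (x i) (x (i + 1)), τ ≤ c + s * t) →
      (∀ i < N, Z i ∨ τ = 1 / 4 → x (i + 1) - x i ≤ 4 * τ / N) →
      ∃ w, w ∈ Spline p 1 N x ∧ MemH 2 w ∧ Clamped (fun t => g 0 t - w t) ∧
        l2norm (fun t => g 0 t - w t) ≤ K * M * (Real.log N / N) ^ (p + 1) * Real.sqrt ε ∧
        ∀ a ∈ Spline p 1 N x, MemH 2 a → |ip (D 2 fun t => g 0 t - w t) (D 2 a)| ≤
          K * M * (Real.log N / N) ^ (p + 1) * Real.sqrt ε * (ε ^ 2)⁻¹ * l2norm (D 2 a) := by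
  have hp' : (3 : ℝ) ≤ p := by exact_mod_cast hp
  have hσ4 : 4 ≤ σ := by linarith
  have hσ0 : 0 ≤ σ := by linarith
  set K0 := (4 * σ) ^ (p + 1) * Real.exp (8 * σ) + 30 * (1 + σ) with hK0
  have hK0p : 0 < K0 := by positivity
  refine ⟨K0 * (1 + σ), by positivity, ?_⟩
  intro ε M c s τ N x g Z hε hε1 hN hcs hx hg hb hτ hZ1 hZ2 hZ3
  have hL := one_le_log_nat hN
  set L := Real.log N with hLdef
  set Λ := (L / N) ^ (p + 1) with hΛ
  have hN0 : (0 : ℝ) < N := by exact_mod_cast (by omega : 0 < N)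
  have hLN : L / N ≤ 1 := (div_le_one hN0).2 ((Real.log_le_sub_one_of_pos hN0).trans (by linarith))
  have hτL : τ ≤ σ * ε * L := hτ ▸ min_le_right _ _
  have hτ4 : τ ≤ 1 / 4 := hτ ▸ min_le_left _ _
  have hτ0 : 0 < τ := by rw [hτ]; exact lt_min (by norm_num) (by positivity)
  have hM : 0 ≤ M := by
    have := (abs_nonneg _).trans (hb 0 (by omega) 0 (by simp))
    exact nonneg_of_mul_nonneg_left this (by positivity)
  have hy : ∀ t ∈ Icc (0 : ℝ) 1, 0 ≤ c + s * t ∧ c + s * t ≤ 1 := fun t ht => by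
    rcases hcs with ⟨rfl, rfl⟩ | ⟨rfl, rfl⟩ <;> constructor <;> linarith [ht.1, ht.2]
  set b : ℝ → ℝ := fun t => 30 * (1 + σ) * M * (Λ * (L⁻¹ * Real.exp (-(c + s * t) / τ))) with hbdef
  have hb0 : ∀ t, 0 ≤ b t := fun t => by positivity
  -- If `τ = 1/4` the mesh is fine enough everywhere, so every element is put into the fine zone and
  -- no cubics are needed. Otherwise `τ = σ ε ln N` and the zones are those of `Z`.
  obtain ⟨Z', q, q₂, hq, hq₂, hh, hmatch, hend, hfine, hcoarse⟩ : ∃ (Z' : ℕ → Prop) (q q₂ : ℝ[X]),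
      q.natDegree ≤ 3 ∧ q₂.natDegree ≤ 3 ∧
      (∀ i < N, Z' i → x (i + 1) - x i ≤ 4 * τ / N) ∧
      (∀ i, i + 1 < N → (Z' i ↔ ¬ Z' (i + 1)) →
        q.eval (x (i + 1)) + q₂.eval (x (i + 1)) = g 0 (x (i + 1)) ∧
        (derivative q).eval (x (i + 1)) + (derivative q₂).eval (x (i + 1)) = g 1 (x (i + 1))) ∧
      (∀ i < N, ∀ ξ ∈ ({0, 1} : Set ℝ), ξ ∈ Icc (x i) (x (i + 1)) →
        (Z' i → q.eval ξ = 0 ∧ (derivative q).eval ξ = 0) ∧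
        (¬ Z' i → q₂.eval ξ = g 0 ξ ∧ (derivative q₂).eval ξ = g 1 ξ)) ∧
      (∀ i < N, Z' i → ∀ t ∈ Icc (x i) (x (i + 1)), |q.eval t| ≤ b t ∧
        |(derivative (derivative q)).eval t| ≤ b t * (ε ^ 2)⁻¹) ∧
      (∀ i < N, ¬ Z' i → ∀ t ∈ Icc (x i) (x (i + 1)), |g 0 t - q₂.eval t| ≤ b t ∧
        |g 2 t - (derivative (derivative q₂)).eval t| ≤ b t * (ε ^ 2)⁻¹) := by
    rcases hτ4.eq_or_lt with h4 | h4
    · refine ⟨fun _ => True, 0, 0, by simp, by simp, fun i hi _ => hZ3 i hi (Or.inr h4), by simp,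
        by simp, fun i hi _ t _ => ?_, by simp⟩
      have := hb0 t
      simp only [derivative_zero, eval_zero, abs_zero]
      exact ⟨this, by positivity⟩
    · have hτ' : τ = σ * ε * L := by
        rw [hτ, min_eq_right_iff]
        by_contra hlt
        rw [min_eq_left (not_le.1 hlt).le] at hτ
        linarith
      obtain ⟨q, q₂, hq, hq₂, h0, hτm, h1, hf, hc⟩ :=
        exists_layer_cubics hp hσ hε hε1 hN hcs hb hτ' h4
      refine ⟨Z, q, q₂, hq, hq₂, fun i hi h => hZ3 i hi (Or.inl h), fun i hi h => ?_,
        fun i hi ξ hξ ht => ⟨fun h => ?_, fun h => ?_⟩, fun i hi h t ht => ?_,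
        fun i hi h t ht => ?_⟩
      · refine hτm _ ?_
        have hr : x (i + 1) ∈ Icc (x i) (x (i + 1)) := right_mem_Icc.2 (hx.lt i (by omega)).le
        have hl : x (i + 1) ∈ Icc (x (i + 1)) (x (i + 1 + 1)) := left_mem_Icc.2 (hx.lt _ hi).le
        by_cases hz : Z i
        · exact le_antisymm (hZ1 i (by omega) hz _ hr) (hZ2 _ hi (h.1 hz) _ hl)
        · have hz' : Z (i + 1) := by tauto
          exact le_antisymm (hZ1 _ hi hz' _ hl) (hZ2 i (by omega) hz _ hr)
      · refine h0 ξ ?_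
        have := hZ1 i hi h ξ ht
        rcases hcs with ⟨rfl, rfl⟩ | ⟨rfl, rfl⟩ <;> rcases hξ with rfl | rfl <;> linarith
      · refine h1 ξ ?_
        have := hZ2 i hi h ξ ht
        rcases hcs with ⟨rfl, rfl⟩ | ⟨rfl, rfl⟩ <;> rcases hξ with rfl | rfl <;> linarith
      · exact hf t (hy t (hx.Icc_subset hi ht)).1 (hZ1 i hi h t ht)
      · have ht' := hx.Icc_subset hi ht
        exact hc t ht' (hZ2 i hi h t ht) (hy t ht').2
  set μ := 4 * σ * (L / N) with hμ
  have hμ0 : 0 ≤ μ := by positivity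
  have hμε : 4 * τ / N ≤ μ * ε := by
    calc 4 * τ / N ≤ 4 * (σ * ε * L) / N := by gcongr
      _ = _ := by rw [hμ]; ring
  have hμ4 : μ ≤ 4 * σ := mul_le_of_le_one_right (by positivity) hLN
  obtain ⟨w, hw, hw2, hcl, hA, hB, -, hD⟩ := exists_two_zone_approx hp hx hg Z' (hq.trans hp)
    (hq₂.trans hp)
    -- A fine element has length at most `μ ε`, so the exponential varies over it by a factor of at
    -- most `exp μ`.
    (G := fun i => M * ((ε ^ (p + 1))⁻¹ * (Real.exp μ * Real.exp (-(c + s * x i) / ε))))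
    (fun i hi h t ht => by
      refine (hb _ le_rfl t (hx.Icc_subset hi ht)).trans ?_
      have := exp_coord_le hε hcs ((hh i hi h).trans hμε) ht (left_mem_Icc.2 (hx.lt i hi).le)
      gcongr) hmatch hend
  set κ := layerWeight ε τ L c s with hκ
  have hκc := continuous_layerWeight ε τ L c s
  have hκL : MemLp κ 2 volΩ := memLp_of_continuousOn hκc.continuousOn
  have hκi := ip_layerWeight_le hε hτ0 hL hσ0 hτL hcs
  have hbκ : ∀ t, b t ≤ 30 * (1 + σ) * M * Λ * κ t := fun t => by
    have : 0 ≤ Real.exp (-(c + s * t) / ε) := (Real.exp_pos _).le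
    simp only [hbdef, hκ, layerWeight, ← mul_assoc (30 * (1 + σ) * M) Λ]
    gcongr
    linarith
  have hκ0 : ∀ t, 0 ≤ κ t := fun t => by
    simp only [hκ, layerWeight]
    positivity
  have hbK : ∀ t, b t ≤ K0 * M * Λ * κ t := fun t => by
    refine (hbκ t).trans ?_
    have := hκ0 t
    gcongr
    rw [hK0]
    linarith [show 0 ≤ (4 * σ) ^ (p + 1) * Real.exp (8 * σ) by positivity]
  have hS : 0 ≤ Real.sqrt ε * (1 + σ) := by positivity
  refine ⟨w, hw, hw2, hcl, ?_, fun a ha ha2 => ?_⟩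
  · have := l2norm_le_of_ae_abs_le (w := fun t => g 0 t - w t) (g := κ) (c := K0 * M * Λ)
      (K := Real.sqrt ε * (1 + σ)) (by positivity) hκL ?_ hκi hS
    · exact this.trans (le_of_eq (by ring))
    · filter_upwards [ae_mem_Ioo] with t ht
      obtain ⟨i, hi, ht⟩ := hx.exists_mem_Icc (Ioo_subset_Icc_self ht)
      by_cases h : Z' i
      · have h1 := hA i hi h t ht
        have h2 := (hfine i hi h t ht).1.trans (hbκ t)
        have hle := (hh i hi h).trans hμε
        have h0 : 0 ≤ x (i + 1) - x i := sub_nonneg.2 (hx.lt i hi).le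
        have hexp := exp_coord_le hε hcs hle (left_mem_Icc.2 (hx.lt i hi).le) ht
        -- The powers of `ε` cancel. Passing from the derivative to the node and back to `t` costs
        -- `exp μ` twice, whence `exp (8σ)`.
        have h3 : (x (i + 1) - x i) ^ (p + 1) * (M * ((ε ^ (p + 1))⁻¹ *
            (Real.exp μ * Real.exp (-(c + s * x i) / ε)))) ≤
            (4 * σ) ^ (p + 1) * Real.exp (8 * σ) * M * Λ * κ t := by
          calc _ ≤ (μ * ε) ^ (p + 1) * (M * ((ε ^ (p + 1))⁻¹ *
                (Real.exp μ * (Real.exp μ * Real.exp (-(c + s * t) / ε))))) := by gcongr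
            _ = (4 * σ) ^ (p + 1) * Real.exp (μ + μ) * M * Λ * Real.exp (-(c + s * t) / ε) := by
                rw [Real.exp_add, hμ, mul_pow, mul_pow _ (L / N), ← hΛ]
                field_simp
            _ ≤ _ := by
                gcongr
                · linarith
                · simp only [hκ, layerWeight]
                  linarith [show 0 ≤ L⁻¹ * Real.exp (-(c + s * t) / τ) by positivity]
        calc |g 0 t - w t| = |(g 0 t - w t - q.eval t) + q.eval t| := by ring_nf
          _ ≤ _ := abs_add_le _ _
          _ ≤ _ := add_le_add (h1.trans h3) h2
          _ = _ := by rw [hK0]; ring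
      · rw [hB i hi h t ht]
        exact (hcoarse i hi h t ht).1.trans (hbK t)
  · have hrc : ContinuousOn (fun t => K0 * M * Λ * (ε ^ 2)⁻¹ * κ t) (Icc 0 1) :=
      (continuous_const.mul hκc).continuousOn
    have hbr : ∀ t, b t * (ε ^ 2)⁻¹ ≤ K0 * M * Λ * (ε ^ 2)⁻¹ * κ t := fun t => by
      calc b t * (ε ^ 2)⁻¹ ≤ K0 * M * Λ * κ t * (ε ^ 2)⁻¹ := by gcongr; exact hbK t
        _ = _ := by ring
    have h := hD _ hrc
      (fun i hi h t ht => (hfine i hi h t (Ioo_subset_Icc_self ht)).2.trans (hbr t))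
      (fun i hi h t ht => (hcoarse i hi h t (Ioo_subset_Icc_self ht)).2.trans (hbr t)) a ha ha2
    refine h.trans (mul_le_mul_of_nonneg_right ?_ (l2norm_nonneg _))
    have := l2norm_le_of_ae_abs_le (w := fun t => K0 * M * Λ * (ε ^ 2)⁻¹ * κ t) (g := κ)
      (c := K0 * M * Λ * (ε ^ 2)⁻¹) (K := Real.sqrt ε * (1 + σ)) (by positivity) hκL
      (.of_forall fun t => ?_) hκi hS
    · exact this.trans (le_of_eq (by ring))
    · rw [abs_of_nonneg]
      have := hκ0 t
      positivity

/-! ### The Shishkin mesh. -/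

section

variable {ε σ : ℝ} {n : ℕ}

theorem shishkin_left {i : ℕ} (hi : i ≤ n) :
    shishkin ε σ (4 * n) i = i * (tau ε σ (4 * n) / n) := by
  rw [shishkin, if_pos (by omega)]
  push_cast
  congr 2
  ring

theorem shishkin_middle (hn : 0 < n) {i : ℕ} (hi : n ≤ i) (hi' : i ≤ 3 * n) :
    shishkin ε σ (4 * n) i =
      tau ε σ (4 * n) + ((i : ℝ) - n) * ((1 - 2 * tau ε σ (4 * n)) / (2 * n)) := by
  have hn' : (0 : ℝ) < n := by exact_mod_cast hn
  rcases hi.eq_or_lt with rfl | h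
  · rw [shishkin_left le_rfl]
    field_simp
    ring
  · rw [shishkin, if_neg (by omega), if_pos (by omega)]
    push_cast
    congr 2 <;> ring

theorem shishkin_right (hn : 0 < n) {i : ℕ} (hi : 3 * n ≤ i) :
    shishkin ε σ (4 * n) i =
      1 - tau ε σ (4 * n) + ((i : ℝ) - 3 * n) * (tau ε σ (4 * n) / n) := by
  have hn' : (0 : ℝ) < n := by exact_mod_cast hn
  rcases hi.eq_or_lt with rfl | h
  · rw [shishkin_middle hn (by omega) le_rfl]
    push_cast
    field_simp
    ring
  · rw [shishkin, if_neg (by omega), if_neg (by omega)]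
    push_cast
    congr 2
    · ring
    · congr 1
      ring

theorem tau_le : tau ε σ (4 * n) ≤ 1 / 4 := min_le_left _ _

theorem tau_pos (hε : 0 < ε) (hσ : 0 < σ) (hn : 0 < n) : 0 < tau ε σ (4 * n) := by
  have := one_le_log_nat (N := 4 * n) (by omega)
  exact lt_min (by norm_num) (by positivity)

theorem shishkin_step_fine (hn : 0 < n) {i : ℕ} (hi : i < n ∨ 3 * n ≤ i) :
    shishkin ε σ (4 * n) (i + 1) - shishkin ε σ (4 * n) i = tau ε σ (4 * n) / n := by
  rcases hi with hi | hi
  · rw [shishkin_left hi, shishkin_left hi.le]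
    push_cast
    ring
  · rw [shishkin_right hn hi, shishkin_right hn (by omega)]
    push_cast
    ring

theorem shishkin_step_coarse (hn : 0 < n) {i : ℕ} (hi : n ≤ i) (hi' : i < 3 * n) :
    shishkin ε σ (4 * n) (i + 1) - shishkin ε σ (4 * n) i =
      (1 - 2 * tau ε σ (4 * n)) / (2 * n) := by
  rw [shishkin_middle hn hi hi'.le, shishkin_middle hn (by omega) hi']
  push_cast
  ring

theorem isMesh_shishkin (hε : 0 < ε) (hσ : 0 < σ) (hn : 0 < n) :
    IsMesh (4 * n) (shishkin ε σ (4 * n)) := by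
  have hn' : (0 : ℝ) < n := by exact_mod_cast hn
  have hτ := tau_pos hε hσ hn
  have hτ4 := tau_le (ε := ε) (σ := σ) (n := n)
  refine ⟨by simp [shishkin_left], ?_, fun i _ => ?_⟩
  · rw [shishkin_right hn (by omega)]
    push_cast
    field_simp
    ring
  · rw [← sub_pos]
    by_cases h : i < n ∨ 3 * n ≤ i
    · rw [shishkin_step_fine hn h]
      positivity
    · rw [shishkin_step_coarse hn (by omega) (by omega)]
      exact div_pos (by linarith) (by positivity)

theorem shishkin_step_le (hn : 0 < n) {i : ℕ} (hi : i < n ∨ 3 * n ≤ i ∨ tau ε σ (4 * n) = 1 / 4) :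
    shishkin ε σ (4 * n) (i + 1) - shishkin ε σ (4 * n) i ≤
      4 * tau ε σ (4 * n) / ((4 * n : ℕ) : ℝ) := by
  have hn' : (0 : ℝ) < n := by exact_mod_cast hn
  have e : 4 * tau ε σ (4 * n) / ((4 * n : ℕ) : ℝ) = tau ε σ (4 * n) / n := by
    push_cast
    field_simp
  by_cases h : i < n ∨ 3 * n ≤ i
  · rw [shishkin_step_fine hn h, e]
  · have h4 : tau ε σ (4 * n) = 1 / 4 := by tauto
    rw [shishkin_step_coarse hn (by omega) (by omega), e, h4]
    apply le_of_eq
    field_simp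
    norm_num

theorem shishkin_step_le_two_div (hε : 0 < ε) (hσ : 0 < σ) (hn : 0 < n) (i : ℕ) :
    shishkin ε σ (4 * n) (i + 1) - shishkin ε σ (4 * n) i ≤ 2 / ((4 * n : ℕ) : ℝ) := by
  have hn' : (0 : ℝ) < n := by exact_mod_cast hn
  have hτ := tau_pos hε hσ hn
  have hτ4 := tau_le (ε := ε) (σ := σ) (n := n)
  have e : 2 / ((4 * n : ℕ) : ℝ) = (1 / 2) / n := by
    push_cast
    field_simp
    norm_num
  rw [e]
  by_cases h : i < n ∨ 3 * n ≤ i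
  · rw [shishkin_step_fine hn h]
    gcongr
    linarith
  · rw [shishkin_step_coarse hn (by omega) (by omega), ← div_div]
    gcongr
    linarith

/-- The approximation result for a layer component at either end point. -/
theorem exists_layer_approx_shishkin {p : ℕ} (hp : 3 ≤ p) {σ : ℝ} (hσ : (p : ℝ) + 1 ≤ σ) :
    ∃ K : ℝ, 0 < K ∧ ∀ {ε M c s : ℝ} {N : ℕ} {g : ℕ → ℝ → ℝ},
      0 < ε → ε ≤ 1 → 0 < N → 4 ∣ N → ((c = 0 ∧ s = 1) ∨ (c = 1 ∧ s = -1)) →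
      DerivChain (p + 1) g →
      (∀ k ≤ p + 1, ∀ t ∈ Icc (0 : ℝ) 1,
        |g k t| ≤ M * ((ε ^ k)⁻¹ * Real.exp (-(c + s * t) / ε))) →
      ∃ w, w ∈ Spline p 1 N (shishkin ε σ N) ∧ MemH 2 w ∧ Clamped (fun t => g 0 t - w t) ∧
        l2norm (fun t => g 0 t - w t) ≤ K * M * (Real.log N / N) ^ (p + 1) * Real.sqrt ε ∧
        ∀ a ∈ Spline p 1 N (shishkin ε σ N), MemH 2 a →
          |ip (D 2 fun t => g 0 t - w t) (D 2 a)| ≤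
          K * M * (Real.log N / N) ^ (p + 1) * Real.sqrt ε * (ε ^ 2)⁻¹ * l2norm (D 2 a) := by
  obtain ⟨K, hK, h⟩ := exists_layer_approx hp hσ
  refine ⟨K, hK, ?_⟩
  rintro ε M c s _ g hε hε1 hN ⟨n, rfl⟩ hcs hg hb
  have hn : 0 < n := by omega
  have hσ0 : 0 < σ := by
    have : (0 : ℝ) ≤ p := Nat.cast_nonneg p
    linarith
  have hx := isMesh_shishkin hε hσ0 hn
  have hτ := tau_pos hε hσ0 hn
  have hτ4 := tau_le (ε := ε) (σ := σ) (n := n)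
  have hn' : (0 : ℝ) < n := by exact_mod_cast hn
  have xn : shishkin ε σ (4 * n) n = tau ε σ (4 * n) := by
    rw [shishkin_left le_rfl]
    field_simp
  have x3n : shishkin ε σ (4 * n) (3 * n) = 1 - tau ε σ (4 * n) := by
    rw [shishkin_right hn le_rfl]
    push_cast
    ring
  rcases hcs with ⟨rfl, rfl⟩ | ⟨rfl, rfl⟩
  -- The fine mesh at the opposite end counts as the outer zone of this layer: only `y ≥ τ` matters
  -- there, not the element length.
  · refine h (τ := tau ε σ (4 * n)) (fun i => i < n) hε hε1 (by omega) (Or.inl ⟨rfl, rfl⟩) hx hg hb rfl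
      (fun i hi hz t ht => ?_) (fun i hi hz t ht => ?_) (fun i hi hz => ?_)
    · have := hx.le (i := i + 1) (j := n) hz (by omega)
      linarith [ht.2]
    · have := hx.le (i := n) (j := i) (not_lt.1 hz) hi.le
      linarith [ht.1]
    · exact shishkin_step_le hn (by tauto)
  · refine h (τ := tau ε σ (4 * n)) (fun i => 3 * n ≤ i) hε hε1 (by omega) (Or.inr ⟨rfl, rfl⟩) hx hg hb rfl
      (fun i hi hz t ht => ?_) (fun i hi hz t ht => ?_) (fun i hi hz => ?_)
    · have := hx.le (i := 3 * n) (j := i) hz hi.le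
      linarith [ht.1]
    · have := hx.le (i := i + 1) (j := 3 * n) (by omega) (by omega)
      linarith [ht.2]
    · exact shishkin_step_le hn (by tauto)

end

/-! ### Coercivity and the energy estimate in abstract form. -/

section

variable {E : Type*} [NormedAddCommGroup E] [InnerProductSpace ℝ E]

theorem abs_le_min_mul {t X Y P Q n : ℝ} (hX : 0 ≤ X) (hY : 0 ≤ Y) (hP : P ≤ n) (hQ : Q ≤ n)
    (h1 : |t| ≤ X * P) (h2 : |t| ≤ Y * Q) : |t| ≤ min X Y * n := by
  rcases min_cases X Y with ⟨h, _⟩ | ⟨h, _⟩ <;> rw [h]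
  · exact h1.trans (mul_le_mul_of_nonneg_left hP hX)
  · exact h2.trans (mul_le_mul_of_nonneg_left hQ hY)

/-- The coefficient of the cross term has modulus at most `2λ - 4`: from below always, from above
because `8 - 2λ ≤ 2λ - 4` means `λ ≥ 3`. Then `2PB ≤ P² + B²` leaves at least `2(P² + B²)`. -/
theorem coercivity_scalar {ε lam A B P Q t : ℝ} (hε : 0 < ε) (hε1 : ε ≤ 1) (hlam : 3 ≤ lam)
    (ht : |t| ≤ P * B) : A ^ 2 + B ^ 2 + P ^ 2 + Q ^ 2 ≤
      lam * (B ^ 2 + P ^ 2) + Q ^ 2 + 16 * A ^ 2 + (4 + 4 * ε - 2 * lam) * t := by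
  have h1 : |(4 + 4 * ε - 2 * lam) * t| ≤ (2 * lam - 4) * (P * B) := by
    rw [abs_mul]
    refine mul_le_mul ?_ ht (abs_nonneg _) (by linarith)
    rw [abs_le]
    constructor <;> linarith
  have h2 := (abs_le.1 h1).1
  nlinarith [mul_nonneg (show 0 ≤ lam - 2 by linarith) (sq_nonneg (P - B)),
    sq_nonneg A, sq_nonneg B, sq_nonneg P]

set_option maxHeartbeats 800000 in
/-- Coercivity of the form and the resulting bound of the discrete error by the consistency
error, in abstract form. -/
theorem norm_add_norm_le_of_form_eq {ε α lam : ℝ} (hε : 0 < ε) (hε1 : ε ≤ 1) (hα : 0 < α)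
    (hα2 : α ^ 2 = ε ^ 3) (hlam : 3 ≤ lam) {a a₂ b b₂ r r₂ l l₂ θ θ₂ : E} {X₁ X₂ : ℝ}
    (hab : inner ℝ a₂ b = inner ℝ a b₂) (hθa : inner ℝ θ₂ a = inner ℝ θ a₂)
    (hrb : inner ℝ r₂ b = inner ℝ r b₂) (hlb : inner ℝ l₂ b = inner ℝ l b₂)
    (hr : inner ℝ r₂ a₂ = 0) (hX₁0 : 0 ≤ X₁) (hX₂0 : 0 ≤ X₂)
    (hl : |inner ℝ l₂ a₂| ≤ X₁ * ‖a₂‖) (hθ : |inner ℝ θ₂ b₂| ≤ X₂ * ‖b₂‖)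
    (hB : lam * inner ℝ (b - α • a₂) (b - α • a₂) +
        inner ℝ ((ε * α) • b₂ + (4 : ℝ) • a) (α • b₂ + (4 : ℝ) • a) =
      lam * inner ℝ (θ - α • (r₂ + l₂)) (b - α • a₂) +
        inner ℝ ((ε * α) • θ₂ + (4 : ℝ) • (r + l)) (α • b₂ + (4 : ℝ) • a)) :
    ‖a‖ + ‖b‖ ≤ 2 * ((2 * lam + 4) * ‖θ‖ + 16 * (‖r‖ + ‖l‖) + lam * (α * X₁) + ε ^ 2 * X₂ +
      |lam - 4| * (min (α * ‖r₂‖) (α / ε ^ 2 * ‖r‖) + α / ε ^ 2 * ‖l‖)) := by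
  simp only [inner_add_left, inner_add_right, inner_sub_left, inner_sub_right,
    real_inner_smul_left, real_inner_smul_right] at hB
  rw [real_inner_comm a₂ b, real_inner_comm a b₂, hab, hθa, hrb, hlb, hr,
    real_inner_self_eq_norm_sq, real_inner_self_eq_norm_sq, real_inner_self_eq_norm_sq,
    real_inner_self_eq_norm_sq] at hB
  -- `P` and `Q` are the weighted second-order parts of the energy norm; `Q` uses `ε α² = ε⁴`.
  set P := α * ‖a₂‖ with hP
  set Q := ε ^ 2 * ‖b₂‖ with hQ
  have hP0 : 0 ≤ P := by positivity
  have hQ0 : 0 ≤ Q := by positivity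
  have hP2 : P ^ 2 = α ^ 2 * ‖a₂‖ ^ 2 := by rw [hP, mul_pow]
  have hQ2 : Q ^ 2 = ε * α ^ 2 * ‖b₂‖ ^ 2 := by rw [hα2, hQ, mul_pow]; ring
  set n := Real.sqrt (‖a‖ ^ 2 + ‖b‖ ^ 2 + P ^ 2 + Q ^ 2) with hn
  have hn2 : n ^ 2 = ‖a‖ ^ 2 + ‖b‖ ^ 2 + P ^ 2 + Q ^ 2 := Real.sq_sqrt (by positivity)
  have hn0 : 0 ≤ n := Real.sqrt_nonneg _
  have han : ‖a‖ ≤ n := Real.le_sqrt_of_sq_le (by nlinarith)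
  have hbn : ‖b‖ ≤ n := Real.le_sqrt_of_sq_le (by nlinarith)
  have hPn : P ≤ n := Real.le_sqrt_of_sq_le (by nlinarith)
  have hQn : Q ≤ n := Real.le_sqrt_of_sq_le (by nlinarith)
  have hcross : |α * inner ℝ a b₂| ≤ P * ‖b‖ := by
    rw [← hab, abs_mul, abs_of_pos hα, hP, mul_assoc]
    exact mul_le_mul_of_nonneg_left (abs_real_inner_le_norm _ _) hα.le
  have hcoer : n ^ 2 ≤ lam * (‖b‖ ^ 2 + P ^ 2) + Q ^ 2 + 16 * ‖a‖ ^ 2 +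
      (4 + 4 * ε - 2 * lam) * (α * inner ℝ a b₂) := by
    rw [hn2]
    exact coercivity_scalar hε hε1 hlam hcross
  have t1 : |lam * inner ℝ θ b| ≤ lam * ‖θ‖ * n := by
    rw [abs_mul, abs_of_nonneg (by linarith), mul_assoc]
    gcongr
    exact (abs_real_inner_le_norm _ _).trans (by gcongr)
  have t2 : |(4 * ε - lam) * (α * inner ℝ θ a₂)| ≤ (lam + 4) * ‖θ‖ * n := by
    rw [abs_mul, mul_assoc]
    refine mul_le_mul ?_ ?_ (abs_nonneg _) (by linarith)
    · rw [abs_le]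
      constructor <;> linarith
    · rw [abs_mul, abs_of_pos hα]
      calc α * |inner ℝ θ a₂| ≤ α * (‖θ‖ * ‖a₂‖) := by
            gcongr
            exact abs_real_inner_le_norm _ _
        _ = ‖θ‖ * P := by rw [hP]; ring
        _ ≤ ‖θ‖ * n := by gcongr
  have t3 : |lam * α ^ 2 * inner ℝ l₂ a₂| ≤ lam * (α * X₁) * n := by
    rw [abs_mul, abs_of_nonneg (by positivity)]
    calc lam * α ^ 2 * |inner ℝ l₂ a₂| ≤ lam * α ^ 2 * (X₁ * ‖a₂‖) := by gcongr
      _ = lam * (α * X₁) * P := by rw [hP]; ring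
      _ ≤ _ := by gcongr
  have t4 : |ε * α ^ 2 * inner ℝ θ₂ b₂| ≤ ε ^ 2 * X₂ * n := by
    rw [abs_mul, abs_of_nonneg (by positivity), hα2]
    calc ε * ε ^ 3 * |inner ℝ θ₂ b₂| ≤ ε * ε ^ 3 * (X₂ * ‖b₂‖) := by gcongr
      _ = ε ^ 2 * X₂ * Q := by rw [hQ]; ring
      _ ≤ _ := by gcongr
  have t5 : |16 * (inner ℝ r a + inner ℝ l a)| ≤ 16 * (‖r‖ + ‖l‖) * n := by
    rw [abs_mul, abs_of_pos (by norm_num), mul_assoc, add_mul]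
    gcongr
    exact (abs_add_le _ _).trans (add_le_add
      ((abs_real_inner_le_norm _ _).trans (by gcongr))
      ((abs_real_inner_le_norm _ _).trans (by gcongr)))
  have hb2 : ∀ y : E, |α * inner ℝ y b₂| ≤ α / ε ^ 2 * ‖y‖ * Q := fun y => by
    rw [abs_mul, abs_of_pos hα]
    calc α * |inner ℝ y b₂| ≤ α * (‖y‖ * ‖b₂‖) := by
          gcongr
          exact abs_real_inner_le_norm _ _
      _ = _ := by rw [hQ]; field_simp
  -- The only term that vanishes for `λ = 4`. For `r` either both derivatives are moved back onto
  -- `r` and paired with `b`, or `b₂` is absorbed in `Q`; for `l` the latter suffices.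
  have t6 : |(4 - lam) * (α * inner ℝ r b₂ + α * inner ℝ l b₂)| ≤
      |lam - 4| * (min (α * ‖r₂‖) (α / ε ^ 2 * ‖r‖) + α / ε ^ 2 * ‖l‖) * n := by
    rw [abs_mul, abs_sub_comm 4 lam, mul_assoc, add_mul]
    gcongr
    refine (abs_add_le _ _).trans (add_le_add ?_ ((hb2 l).trans (by gcongr)))
    refine abs_le_min_mul (by positivity) (by positivity) hbn hQn ?_ (hb2 r)
    rw [← hrb, abs_mul, abs_of_pos hα, mul_assoc]
    exact mul_le_mul_of_nonneg_left (abs_real_inner_le_norm _ _) hα.le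
  set S := (2 * lam + 4) * ‖θ‖ + 16 * (‖r‖ + ‖l‖) + lam * (α * X₁) + ε ^ 2 * X₂ +
      |lam - 4| * (min (α * ‖r₂‖) (α / ε ^ 2 * ‖r‖) + α / ε ^ 2 * ‖l‖) with hS
  have hnS : n * n ≤ S * n := by
    have e1 : lam * (‖b‖ ^ 2 + P ^ 2) + Q ^ 2 + 16 * ‖a‖ ^ 2 +
        (4 + 4 * ε - 2 * lam) * (α * inner ℝ a b₂) =
        lam * inner ℝ θ b + (4 * ε - lam) * (α * inner ℝ θ a₂) +
        lam * α ^ 2 * inner ℝ l₂ a₂ + ε * α ^ 2 * inner ℝ θ₂ b₂ +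
        16 * (inner ℝ r a + inner ℝ l a) +
        (4 - lam) * (α * inner ℝ r b₂ + α * inner ℝ l b₂) := by
      rw [hP2, hQ2]
      linarith
    rw [e1] at hcoer
    have e2 : S * n = lam * ‖θ‖ * n + (lam + 4) * ‖θ‖ * n + lam * (α * X₁) * n +
        ε ^ 2 * X₂ * n + 16 * (‖r‖ + ‖l‖) * n +
        |lam - 4| * (min (α * ‖r₂‖) (α / ε ^ 2 * ‖r‖) + α / ε ^ 2 * ‖l‖) * n := by
      rw [hS]; ring
    rw [e2, ← pow_two]
    linarith [le_abs_self (lam * inner ℝ θ b), le_abs_self ((4 * ε - lam) * (α * inner ℝ θ a₂)),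
      le_abs_self (lam * α ^ 2 * inner ℝ l₂ a₂), le_abs_self (ε * α ^ 2 * inner ℝ θ₂ b₂),
      le_abs_self (16 * (inner ℝ r a + inner ℝ l a)),
      le_abs_self ((4 - lam) * (α * inner ℝ r b₂ + α * inner ℝ l b₂))]
  have hS0 : 0 ≤ S := by positivity
  have hnS' : n ≤ S := by
    rcases hn0.eq_or_lt with h | h
    · rw [← h]; exact hS0
    · exact le_of_mul_le_mul_right hnS h
  linarith

end

/-! ### From spline approximations to the error of the method. -/

/-- `W` is the element of `L₂(Ω)` given by the function `w`. -/
def Represents (w : ℝ → ℝ) (W : Lp ℝ 2 volΩ) : Prop := w =ᵐ[volΩ] W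

namespace Represents

variable {w z : ℝ → ℝ} {W Z : Lp ℝ 2 volΩ}

theorem toLp (hw : MemLp w 2 volΩ) : Represents w (hw.toLp w) := hw.coeFn_toLp.symm

theorem add (hw : Represents w W) (hz : Represents z Z) :
    Represents (fun t => w t + z t) (W + Z) := by
  filter_upwards [hw, hz, Lp.coeFn_add W Z] with t h1 h2 h3
  rw [h1, h2, h3, Pi.add_apply]

theorem sub (hw : Represents w W) (hz : Represents z Z) :
    Represents (fun t => w t - z t) (W - Z) := by
  filter_upwards [hw, hz, Lp.coeFn_sub W Z] with t h1 h2 h3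
  rw [h1, h2, h3, Pi.sub_apply]

theorem const_mul (hw : Represents w W) (c : ℝ) : Represents (fun t => c * w t) (c • W) := by
  filter_upwards [hw, Lp.coeFn_smul c W] with t h1 h2
  rw [h1, h2, Pi.smul_apply, smul_eq_mul]

theorem congr (hw : Represents w W) (h : z =ᵐ[volΩ] w) : Represents z W := h.trans hw

theorem ip_eq (hw : Represents w W) (hz : Represents z Z) : ip w z = inner ℝ W Z := by
  rw [ip_congr hw hz, L2.inner_def, ip_eq_integral]
  refine integral_congr_ae (.of_forall fun x => ?_)
  simp [mul_comm]

theorem l2norm_eq (hw : Represents w W) : l2norm w = ‖W‖ := by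
  rw [l2norm, hw.ip_eq hw, real_inner_self_eq_norm_sq, Real.sqrt_sq (norm_nonneg _)]

end Represents

theorem l2norm_add_le {w z : ℝ → ℝ} (hw : MemLp w 2 volΩ) (hz : MemLp z 2 volΩ) :
    l2norm (fun t => w t + z t) ≤ l2norm w + l2norm z := by
  have h1 := Represents.toLp hw
  have h2 := Represents.toLp hz
  rw [(h1.add h2).l2norm_eq, h1.l2norm_eq, h2.l2norm_eq]
  exact norm_add_le _ _

theorem ip_add_left {w w' z : ℝ → ℝ} (hw : MemLp w 2 volΩ) (hw' : MemLp w' 2 volΩ)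
    (hz : MemLp z 2 volΩ) : ip (fun t => w t + w' t) z = ip w z + ip w' z := by
  have h1 := Represents.toLp hw
  have h2 := Represents.toLp hw'
  have h3 := Represents.toLp hz
  rw [(h1.add h2).ip_eq h3, h1.ip_eq h3, h2.ip_eq h3, inner_add_left]

theorem Spline.add {p k N : ℕ} {x : ℕ → ℝ} {s s' : ℝ → ℝ} (hs : s ∈ Spline p k N x)
    (hs' : s' ∈ Spline p k N x) : (fun t => s t + s' t) ∈ Spline p k N x := by
  refine ⟨hs.1.add hs'.1, fun i hi => ?_⟩
  obtain ⟨q, hq, h⟩ := hs.2 i hi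
  obtain ⟨q', hq', h'⟩ := hs'.2 i hi
  refine ⟨q + q', (Polynomial.natDegree_add_le _ _).trans (max_le hq hq'), fun t ht => ?_⟩
  simp only [h t ht, h' t ht, Polynomial.eval_add]

theorem Spline.sub {p k N : ℕ} {x : ℕ → ℝ} {s s' : ℝ → ℝ} (hs : s ∈ Spline p k N x)
    (hs' : s' ∈ Spline p k N x) : (fun t => s t - s' t) ∈ Spline p k N x := by
  refine ⟨hs.1.sub hs'.1, fun i hi => ?_⟩
  obtain ⟨q, hq, h⟩ := hs.2 i hi
  obtain ⟨q', hq', h'⟩ := hs'.2 i hi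
  refine ⟨q - q', (Polynomial.natDegree_sub_le _ _).trans (max_le hq hq'), fun t ht => ?_⟩
  simp only [h t ht, h' t ht, Polynomial.eval_sub]

theorem D_congr {w z : ℝ → ℝ} (h : EqOn w z (Icc 0 1)) (k : ℕ) : EqOn (D k w) (D k z) (Icc 0 1) :=
  iteratedDerivWithin_congr h

theorem D_add {n k : ℕ} {w z : ℝ → ℝ} (hw : ContDiffOn ℝ n w (Icc 0 1))
    (hz : ContDiffOn ℝ n z (Icc 0 1)) (hk : k ≤ n) {t : ℝ} (ht : t ∈ Icc (0 : ℝ) 1) :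
    D k (fun t => w t + z t) t = D k w t + D k z t :=
  iteratedDerivWithin_fun_add ht uniqueDiffOn_unit
    ((hw t ht).of_le (by exact_mod_cast hk)) ((hz t ht).of_le (by exact_mod_cast hk))

/-- `w` and `W` are splines approximating `φ` and `α φ''` with errors `η` and `θ`. -/
structure SplineApprox (p N : ℕ) (x : ℕ → ℝ) (α : ℝ) (φ w W η θ : ℝ → ℝ) : Prop where
  spline : w ∈ Spline p 1 N x
  spline' : W ∈ Spline p 1 N x
  memH : MemH 2 w
  memH' : MemH 2 W
  memH_error : MemH 2 η
  memH_error' : MemH 2 θ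
  clamped : Clamped η
  eqOn : ∀ t ∈ Icc (0 : ℝ) 1, φ t = w t + η t
  eqOn' : ∀ t ∈ Icc (0 : ℝ) 1, α * D 2 φ t = W t + θ t
  ae_eq : ∀ᵐ t ∂volΩ, D 2 φ t = D 2 w t + D 2 η t
  ae_eq' : ∀ᵐ t ∂volΩ, α * D 4 φ t = D 2 W t + D 2 θ t

namespace SplineApprox

variable {p N : ℕ} {x : ℕ → ℝ} {α : ℝ} {φ w W η θ φ' w' W' η' θ' : ℝ → ℝ}

theorem congr (h : SplineApprox p N x α φ w W η θ) (he : EqOn φ' φ (Icc 0 1)) :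
    SplineApprox p N x α φ' w W η θ where
  spline := h.spline
  spline' := h.spline'
  memH := h.memH
  memH' := h.memH'
  memH_error := h.memH_error
  memH_error' := h.memH_error'
  clamped := h.clamped
  eqOn t ht := by rw [he ht, h.eqOn t ht]
  eqOn' t ht := by rw [D_congr he 2 ht, h.eqOn' t ht]
  ae_eq := by
    filter_upwards [h.ae_eq, ae_mem_Ioo] with t h1 h2
    rw [D_congr he 2 (Ioo_subset_Icc_self h2), h1]
  ae_eq' := by
    filter_upwards [h.ae_eq', ae_mem_Ioo] with t h1 h2
    rw [D_congr he 4 (Ioo_subset_Icc_self h2), h1]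

theorem add (h : SplineApprox p N x α φ w W η θ) (h' : SplineApprox p N x α φ' w' W' η' θ')
    (hc : ContDiffOn ℝ (4 : ℕ) φ (Icc 0 1))
    (hc' : ContDiffOn ℝ (4 : ℕ) φ' (Icc 0 1)) :
    SplineApprox p N x α (fun t => φ t + φ' t) (fun t => w t + w' t) (fun t => W t + W' t)
      (fun t => η t + η' t) (fun t => θ t + θ' t) where
  spline := Spline.add h.spline h'.spline
  spline' := Spline.add h.spline' h'.spline'
  memH := (h.memH.add h'.memH).1
  memH' := (h.memH'.add h'.memH').1
  memH_error := (h.memH_error.add h'.memH_error).1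
  memH_error' := (h.memH_error'.add h'.memH_error').1
  clamped := Clamped.add h.memH_error h'.memH_error h.clamped h'.clamped
  eqOn t ht := by rw [h.eqOn t ht, h'.eqOn t ht]; ring
  eqOn' t ht := by
    rw [D_add (n := 4) hc hc' (by norm_num) ht, mul_add, h.eqOn' t ht, h'.eqOn' t ht]; ring
  ae_eq := by
    filter_upwards [h.ae_eq, h'.ae_eq, ae_mem_Ioo, (h.memH.add h'.memH).2.2,
      (h.memH_error.add h'.memH_error).2.2] with t h1 h2 h3 h4 h5
    rw [D_add (n := 4) hc hc' (by norm_num) (Ioo_subset_Icc_self h3), h1, h2, h4, h5]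
    ring
  ae_eq' := by
    filter_upwards [h.ae_eq', h'.ae_eq', ae_mem_Ioo, (h.memH'.add h'.memH').2.2,
      (h.memH_error'.add h'.memH_error').2.2] with t h1 h2 h3 h4 h5
    rw [D_add (n := 4) hc hc' le_rfl (Ioo_subset_Icc_self h3), mul_add, h1, h2, h4, h5]
    ring

theorem of_splines {n : ℕ} (hn : 5 ≤ n) (hφ : ContDiffOn ℝ n φ (Icc 0 1))
    (hw : w ∈ Spline p 1 N x) (hW : W ∈ Spline p 1 N x) (hw2 : MemH 2 w) (hW2 : MemH 2 W)
    (hcl : Clamped fun t => φ t - w t) :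
    SplineApprox p N x α φ w W (fun t => φ t - w t) (fun t => α * D 2 φ t - W t) := by
  have hg := derivChain_of_contDiffOn hφ
  obtain ⟨m, rfl⟩ : ∃ m, n = m + 2 := ⟨n - 2, by omega⟩
  have hg' := hg.const_mul_shift α
  have h1 := hg.memH_two (by omega)
  have h2 := hg'.memH_two (by omega)
  rw [D_zero] at h1
  simp only [zero_add] at h2
  refine ⟨hw, hW, hw2, hW2, (h1.sub hw2).1, (h2.sub hW2).1, hcl, fun t _ => by ring,
    fun t _ => by ring, ?_, ?_⟩
  · filter_upwards [(h1.sub hw2).2.2] with t ht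
    rw [ht]; ring
  · filter_upwards [(h2.sub hW2).2.2, ae_mem_Ioo] with t ht hm
    have := hg'.D_eqOn (k := 2) (by omega) (Ioo_subset_Icc_self hm)
    simp only [zero_add] at this
    rw [ht, this]; ring

end SplineApprox

/-- The discrete problem is tested with its own error `(a, b)` relative to the spline pair. The
error of `u` is split into `r`, orthogonal in the second derivatives, and the layer part `l`, as the
two are estimated differently. -/
theorem fem_error_le {p N : ℕ} {ε lam σ α : ℝ} (hε : 0 < ε) (hε1 : ε ≤ 1) (hlam : 3 ≤ lam)
    (hα : 0 < α) (hα2 : α ^ 2 = ε ^ 3) (hα3 : ε ^ (3 / 2 : ℝ) = α) (hα5 : ε ^ (5 / 2 : ℝ) = ε * α)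
    {f u uh vh w W r l θ : ℝ → ℝ} (hf : MemLp f 2 volΩ) (hu : IsSolution ε f u)
    (hu2 : MemH 2 u) (hfem : IsFEMSolution p ε lam σ N f uh vh)
    (hA : SplineApprox p N (shishkin ε σ N) α u w W (fun t => l t + r t) θ)
    (hr2 : MemH 2 r) (hl2 : MemH 2 l) (hr : Clamped r) (hl : Clamped l) {X₁ X₂ : ℝ}
    (hX₁0 : 0 ≤ X₁) (hX₂0 : 0 ≤ X₂)
    (hro : ∀ a ∈ Spline p 1 N (shishkin ε σ N), MemH 2 a → ip (D 2 r) (D 2 a) = 0)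
    (hX₁ : ∀ a ∈ Spline p 1 N (shishkin ε σ N), MemH 2 a →
      |ip (D 2 l) (D 2 a)| ≤ X₁ * l2norm (D 2 a))
    (hX₂ : ∀ a ∈ Spline p 1 N (shishkin ε σ N), MemH 2 a →
      |ip (D 2 θ) (D 2 a)| ≤ X₂ * l2norm (D 2 a)) :
    l2error ε u uh vh ≤ l2norm r + l2norm l + l2norm θ +
      2 * ((2 * lam + 4) * l2norm θ + 16 * (l2norm r + l2norm l) + lam * (α * X₁) + ε ^ 2 * X₂ +
      |lam - 4| * (min (α * l2norm (D 2 r)) (α / ε ^ 2 * l2norm r) + α / ε ^ 2 * l2norm l)) := by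
  obtain ⟨⟨⟨huhs, hvhs⟩, ⟨huh2, huhc⟩, hvh2⟩, heq⟩ := hfem
  obtain ⟨-, hode, huc⟩ := hu
  simp only at huhs hvhs huh2 huhc hvh2
  have ha := huh2.sub hA.memH
  have hb := hvh2.sub hA.memH'
  have hη := hl2.add hr2
  -- The approximation inherits the boundary conditions from `u` and from its clamped error; this
  -- makes `(a, b)` an admissible test pair.
  have hwc : Clamped w := by
    have h := Clamped.sub hu2 hA.memH_error huc hA.clamped
    have he : EqOn w (fun t => u t - (l t + r t)) (Icc 0 1) := fun t ht => by
      simp only [hA.eqOn t ht]; ring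
    intro ξ hξ
    have hm : ξ ∈ Icc (0 : ℝ) 1 := by rcases hξ with rfl | rfl <;> simp
    rw [he hm, D_congr he 1 hm]
    exact h ξ hξ
  have hac : Clamped fun t => uh t - w t := Clamped.sub huh2 hA.memH huhc hwc
  set a : ℝ → ℝ := fun t => uh t - w t with ha_def
  set b : ℝ → ℝ := fun t => vh t - W t with hb_def
  have has : a ∈ Spline p 1 N (shishkin ε σ N) := Spline.sub huhs hA.spline
  have hbs : b ∈ Spline p 1 N (shishkin ε σ N) := Spline.sub hvhs hA.spline'
  have hz := heq (a, b) ⟨⟨has, hbs⟩, ⟨ha.1, hac⟩, hb.1⟩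
  simp only [B, F, hα3, hα5] at hz
  have Ra := Represents.toLp ha.1.memLp
  have Ra2 := Represents.toLp ha.1.memLp_D
  have Rb := Represents.toLp hb.1.memLp
  have Rb2 := Represents.toLp hb.1.memLp_D
  have Rr := Represents.toLp hr2.memLp
  have Rr2 := Represents.toLp hr2.memLp_D
  have Rl := Represents.toLp hl2.memLp
  have Rl2 := Represents.toLp hl2.memLp_D
  have Rθ := Represents.toLp hA.memH_error'.memLp
  have Rθ2 := Represents.toLp hA.memH_error'.memLp_D
  have Rf := Represents.toLp hf
  have Rz1 := Rb.sub (Ra2.const_mul α)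
  have Rz2 := (Rb2.const_mul α).add (Ra.const_mul 4)
  have Ry2 := (Rb2.const_mul (ε * α)).add (Ra.const_mul 4)
  have Re1 := Rθ.sub ((Rr2.add Rl2).const_mul α)
  have Re2 := (Rθ2.const_mul (ε * α)).add ((Rr.add Rl).const_mul 4)
  have RG1 := (Rz1.sub Re1).congr (z := fun t => vh t - α * D 2 uh t) (by
    filter_upwards [ha.2.2, hη.2.2, hA.ae_eq, ae_mem_Ioo] with t h1 h2 h3 h4
    have h5 := hA.eqOn' t (Ioo_subset_Icc_self h4)
    rw [h2] at h3
    rw [h1]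
    linear_combination α * h3 - h5)
  -- Consistency of the second equation: the differential equation and `ε α² = ε⁴` replace the exact
  -- part by `f`.
  have RG2 := ((Ry2.add Rf).sub Re2).congr (z := fun t => ε * α * D 2 vh t + 4 * uh t) (by
    filter_upwards [hb.2.2, hA.ae_eq', ae_mem_Ioo, hode] with t h1 h2 h3 h4
    have h5 := hA.eqOn t (Ioo_subset_Icc_self h3)
    rw [h1]
    linear_combination (-(ε * α)) * h2 - 4 * h5 + h4 + ε * D 4 u t * hα2)
  rw [RG1.ip_eq Rz1, RG2.ip_eq Rz2, Rf.ip_eq Rz2, inner_sub_left, inner_sub_left (_ + _),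
    inner_add_left _ (MemLp.toLp f hf)] at hz
  have hab := ip_D_two_comm hb.1 ha.1 hac
  rw [ip_comm, ip_comm b] at hab
  have key := norm_add_norm_le_of_form_eq hε hε1 hα hα2 hlam (X₁ := X₁) (X₂ := X₂)
    (a := ha.1.memLp.toLp a) (a₂ := ha.1.memLp_D.toLp (D 2 a))
    (b := hb.1.memLp.toLp b) (b₂ := hb.1.memLp_D.toLp (D 2 b))
    (r := hr2.memLp.toLp r) (r₂ := hr2.memLp_D.toLp (D 2 r))
    (l := hl2.memLp.toLp l) (l₂ := hl2.memLp_D.toLp (D 2 l))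
    (θ := hA.memH_error'.memLp.toLp θ) (θ₂ := hA.memH_error'.memLp_D.toLp (D 2 θ))
    (by rw [← Ra2.ip_eq Rb, ← Ra.ip_eq Rb2, hab])
    (by rw [← Rθ2.ip_eq Ra, ← Rθ.ip_eq Ra2, ip_D_two_comm hA.memH_error' ha.1 hac])
    (by rw [← Rr2.ip_eq Rb, ← Rr.ip_eq Rb2, ip_comm, ← ip_D_two_comm hb.1 hr2 hr, ip_comm])
    (by rw [← Rl2.ip_eq Rb, ← Rl.ip_eq Rb2, ip_comm, ← ip_D_two_comm hb.1 hl2 hl, ip_comm])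
    (by rw [← Rr2.ip_eq Ra2, hro a has ha.1]) hX₁0 hX₂0
    (by rw [← Rl2.ip_eq Ra2, ← Ra2.l2norm_eq]; exact hX₁ a has ha.1)
    (by rw [← Rθ2.ip_eq Rb2, ← Rb2.l2norm_eq]; exact hX₂ b hbs hb.1)
    (by linarith)
  rw [← Ra.l2norm_eq, ← Rb.l2norm_eq, ← Rr.l2norm_eq, ← Rl.l2norm_eq, ← Rθ.l2norm_eq,
    ← Rr2.l2norm_eq] at key
  have Ru := ((Rr.add Rl).sub Ra).congr (z := fun t => u t - uh t) (by
    filter_upwards [ae_mem_Ioo] with t ht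
    have h5 := hA.eqOn t (Ioo_subset_Icc_self ht)
    simp only [ha_def]
    linear_combination h5)
  have Rv := (Rθ.sub Rb).congr (z := fun t => α * D 2 u t - vh t) (by
    filter_upwards [ae_mem_Ioo] with t ht
    have h5 := hA.eqOn' t (Ioo_subset_Icc_self ht)
    simp only [hb_def]
    linear_combination h5)
  have e1 : l2norm (fun t => u t - uh t) ≤ l2norm r + l2norm l + l2norm a := by
    rw [Ru.l2norm_eq, Rr.l2norm_eq, Rl.l2norm_eq, Ra.l2norm_eq]
    exact (norm_sub_le _ _).trans (by gcongr; exact norm_add_le _ _)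
  have e2 : l2norm (fun t => α * D 2 u t - vh t) ≤ l2norm θ + l2norm b := by
    rw [Rv.l2norm_eq, Rθ.l2norm_eq, Rb.l2norm_eq]
    exact norm_sub_le _ _
  rw [l2error, hα3]
  linarith

/-! ### Application to the components of the solution and the final bound. -/

theorem exists_regular_component {p : ℕ} (hp : 3 ≤ p) {N : ℕ} {x : ℕ → ℝ} (hx : IsMesh N x) {H : ℝ}
    (hH : ∀ i < N, x (i + 1) - x i ≤ H) {M α : ℝ} (hα : 0 < α) {φ : ℝ → ℝ}
    (hφ : ContDiffOn ℝ (p + 3 : ℕ) φ (Icc 0 1))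
    (hb : ∀ k ≤ p + 3, ∀ t ∈ Icc (0 : ℝ) 1, |D k φ t| ≤ M) :
    ∃ w W η θ, SplineApprox p N x α φ w W η θ ∧
      l2norm η ≤ H ^ (p + 1) * M ∧ l2norm (D 2 η) ≤ H ^ (p - 1) * M ∧
      l2norm θ ≤ H ^ (p + 1) * (α * M) ∧
      (∀ a ∈ Spline p 1 N x, MemH 2 a → ip (D 2 η) (D 2 a) = 0) ∧
      (∀ a ∈ Spline p 1 N x, MemH 2 a → ip (D 2 θ) (D 2 a) = 0) := by
  have hg := derivChain_of_contDiffOn hφ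
  have hg' : DerivChain (p + 1) fun k t => α * D (k + 2) φ t :=
    DerivChain.const_mul_shift (n := p + 1) (m := 2) hg α
  obtain ⟨w, hw, hw2, hcl, h1, h2, h3⟩ := exists_regular_approx hp hx hH
    (g := fun k => D k φ) (fun k hk => hg k (by omega)) (hb (p + 1) (by omega))
  obtain ⟨W, hW, hW2, -, h1', -, h3'⟩ := exists_regular_approx hp hx hH hg'
    (M := α * M) (fun t ht => by
      rw [abs_mul, abs_of_pos hα]
      exact mul_le_mul_of_nonneg_left (hb _ le_rfl t ht) hα.le)
  simp only [D_zero, zero_add] at hcl h1 h2 h3 h1' h3'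
  exact ⟨w, W, _, _, SplineApprox.of_splines (by omega) hφ hw hW hw2 hW2 hcl, h1, h2, h1', h3, h3'⟩

/-- Two derivatives of a layer cost `ε⁻²`, so `α φ''` is again a layer function, with constant `α/ε²
* M`, and the same approximation result applies to it. -/
theorem exists_layer_component {p : ℕ} (hp : 3 ≤ p) {σ : ℝ} (hσ : (p : ℝ) + 1 ≤ σ) :
    ∃ K : ℝ, 0 < K ∧ ∀ {ε M c s α : ℝ} {N : ℕ} {φ : ℝ → ℝ},
      0 < ε → ε ≤ 1 → 0 < N → 4 ∣ N → ((c = 0 ∧ s = 1) ∨ (c = 1 ∧ s = -1)) → 0 < α →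
      ContDiffOn ℝ (p + 3 : ℕ) φ (Icc 0 1) →
      (∀ k ≤ p + 3, ∀ t ∈ Icc (0 : ℝ) 1,
        |D k φ t| ≤ M * ((ε ^ k)⁻¹ * Real.exp (-(c + s * t) / ε))) →
      ∃ w W η θ, SplineApprox p N (shishkin ε σ N) α φ w W η θ ∧
        l2norm η ≤ K * M * (Real.log N / N) ^ (p + 1) * Real.sqrt ε ∧
        l2norm θ ≤ K * (α / ε ^ 2 * M) * (Real.log N / N) ^ (p + 1) * Real.sqrt ε ∧
        (∀ a ∈ Spline p 1 N (shishkin ε σ N), MemH 2 a → |ip (D 2 η) (D 2 a)| ≤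
          K * M * (Real.log N / N) ^ (p + 1) * Real.sqrt ε * (ε ^ 2)⁻¹ * l2norm (D 2 a)) ∧
        (∀ a ∈ Spline p 1 N (shishkin ε σ N), MemH 2 a → |ip (D 2 θ) (D 2 a)| ≤
          K * (α / ε ^ 2 * M) * (Real.log N / N) ^ (p + 1) * Real.sqrt ε * (ε ^ 2)⁻¹ *
            l2norm (D 2 a)) := by
  obtain ⟨K, hK, H⟩ := exists_layer_approx_shishkin hp hσ
  refine ⟨K, hK, ?_⟩
  intro ε M c s α N φ hε hε1 hN hN4 hcs hα hφ hb
  have hg := derivChain_of_contDiffOn hφ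
  have hg' : DerivChain (p + 1) fun k t => α * D (k + 2) φ t :=
    DerivChain.const_mul_shift (n := p + 1) (m := 2) hg α
  obtain ⟨w, hw, hw2, hcl, h1, h2⟩ := H hε hε1 hN hN4 hcs (g := fun k => D k φ)
    (fun k hk => hg k (by omega)) (fun k hk => hb k (by omega))
  obtain ⟨W, hW, hW2, -, h1', h2'⟩ := H hε hε1 hN hN4 hcs hg' (M := α / ε ^ 2 * M)
    (fun k hk t ht => by
      rw [abs_mul, abs_of_pos hα]
      refine (mul_le_mul_of_nonneg_left (hb (k + 2) (by omega) t ht) hα.le).trans (le_of_eq ?_)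
      field_simp
      ring)
  simp only [D_zero, zero_add] at hcl h1 h2 h1' h2'
  exact ⟨w, W, _, _, SplineApprox.of_splines (by omega) hφ hw hW hw2 hW2 hcl, h1, h1', h2, h2'⟩

theorem abs_ip_D_two_add_le {w z a : ℝ → ℝ} (hw : MemH 2 w) (hz : MemH 2 z) (ha : MemH 2 a)
    {A A' : ℝ} (h : |ip (D 2 w) (D 2 a)| ≤ A) (h' : |ip (D 2 z) (D 2 a)| ≤ A') :
    |ip (D 2 fun t => w t + z t) (D 2 a)| ≤ A + A' := by
  rw [ip_congr (hw.add hz).2.2 (Filter.EventuallyEq.refl _ _),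
    ip_add_left hw.memLp_D hz.memLp_D ha.memLp_D]
  exact (abs_add_le _ _).trans (add_le_add h h')

theorem rpow_three_halves {ε : ℝ} (hε : 0 < ε) : ε ^ (3 / 2 : ℝ) = ε * Real.sqrt ε := by
  rw [Real.sqrt_eq_rpow, show (3 / 2 : ℝ) = 1 + 1 / 2 by norm_num, Real.rpow_add hε, Real.rpow_one]

theorem rpow_five_halves {ε : ℝ} (hε : 0 < ε) :
    ε ^ (5 / 2 : ℝ) = ε * (ε * Real.sqrt ε) := by
  rw [← rpow_three_halves hε, show (5 / 2 : ℝ) = 1 + 3 / 2 by norm_num, Real.rpow_add hε,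
    Real.rpow_one]

theorem rpow_neg_half {ε : ℝ} (hε : 0 < ε) :
    ε ^ (-(1 / 2) : ℝ) = ε * Real.sqrt ε / ε ^ 2 := by
  rw [Real.rpow_neg hε.le, ← Real.sqrt_eq_rpow]
  have h : Real.sqrt ε * Real.sqrt ε = ε := Real.mul_self_sqrt hε.le
  have h0 : Real.sqrt ε ≠ 0 := (Real.sqrt_pos.2 hε).ne'
  field_simp
  linear_combination -h

theorem exists_error_bound (p : ℕ) (hp : 3 ≤ p) (lam : ℝ) (hlam : 3 ≤ lam) (σ : ℝ)
    (hσ : (p : ℝ) + 1 ≤ σ) (M : ℝ) :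
    ∃ C : ℝ, 0 < C ∧ ∀ ε : ℝ, 0 < ε → ε ≤ 1 → ∀ N : ℕ, 0 < N → 4 ∣ N →
      ∀ f u : ℝ → ℝ, MemLp f 2 volΩ → IsSolution ε f u → HasDecomposition (p + 3) M ε f u →
      ∀ uh vh : ℝ → ℝ, IsFEMSolution p ε lam σ N f uh vh →
        l2error ε u uh vh ≤ C * ((Real.log N ^ (p + 1) +
          |lam - 4| * min (ε ^ (3 / 2 : ℝ) * (N : ℝ) ^ 2) (ε ^ (-(1 / 2) : ℝ))) *
            ((N : ℝ) ^ (p + 1))⁻¹) := by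
  obtain ⟨K, hK, HK⟩ := exists_layer_component hp hσ
  set T := (2 * K + 2 ^ (p + 1)) * |M| + 1 with hT
  have hT0 : 0 < T := by positivity
  refine ⟨T * (4 + 2 * (3 * (2 * lam + 4) + 48 + lam + 1 + |lam - 4|)), by positivity, ?_⟩
  intro ε hε hε1 N hN hN4 f u hf hu hdec uh vh hfem
  obtain ⟨u₀, ur, u₁, c₀, cr, c₁, hsum, br, b₀, b₁, -, -, -⟩ := hdec
  have hσ0 : 0 < σ := by
    have : (0 : ℝ) ≤ p := Nat.cast_nonneg p
    linarith
  obtain ⟨hx, hH⟩ : IsMesh N (shishkin ε σ N) ∧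
      ∀ i < N, shishkin ε σ N (i + 1) - shishkin ε σ N i ≤ 2 / N := by
    obtain ⟨n, rfl⟩ := hN4
    exact ⟨isMesh_shishkin hε hσ0 (by omega),
      fun i _ => shishkin_step_le_two_div hε hσ0 (by omega) i⟩
  have hN4' : 4 ≤ N := Nat.le_of_dvd hN hN4
  have hL := one_le_log_nat hN4'
  have hN0 : (0 : ℝ) < N := by exact_mod_cast hN
  have hM : 0 ≤ M := (abs_nonneg _).trans (br 0 (by omega) 0 (by simp))
  rw [abs_of_nonneg hM] at hT
  rw [rpow_three_halves hε, rpow_neg_half hε]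
  have hsq : 0 < Real.sqrt ε := Real.sqrt_pos.2 hε
  have hsq1 : Real.sqrt ε ≤ 1 := Real.sqrt_le_one.2 hε1
  have hss : Real.sqrt ε * Real.sqrt ε = ε := Real.mul_self_sqrt hε.le
  set α := ε * Real.sqrt ε with hα
  have hα0 : 0 < α := by positivity
  have hα1 : α ≤ 1 := mul_le_one₀ hε1 hsq.le hsq1
  have hα2 : α ^ 2 = ε ^ 3 := by rw [hα, mul_pow, Real.sq_sqrt hε.le]; ring
  -- The balance behind robustness: the factor `ε^{-1/2}` is cancelled by the `√ε` from the width of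
  -- the layer.
  have hαs : α / ε ^ 2 * Real.sqrt ε = 1 := by
    rw [hα]
    field_simp
    linear_combination hss
  obtain ⟨wr, Wr, r, θr, Ar, r1, r2, r3, r4, r5⟩ :=
    exists_regular_component hp hx hH hα0 cr br
  obtain ⟨w0, W0, l0, θ0, A0, l01, l02, l03, l04⟩ :=
    HK (c := 0) (s := 1) hε hε1 hN hN4 (Or.inl ⟨rfl, rfl⟩) hα0 c₀ (by simpa using b₀)
  obtain ⟨w1, W1, l1, θ1, A1, l11, l12, l13, l14⟩ :=
    HK (c := 1) (s := -1) hε hε1 hN hN4 (Or.inr ⟨rfl, rfl⟩) hα0 c₁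
      (by simpa [← sub_eq_add_neg] using b₁)
  have h4 : ((4 : ℕ) : WithTop ℕ∞) ≤ ((p + 3 : ℕ) : WithTop ℕ∞) := by
    exact_mod_cast (by omega : 4 ≤ p + 3)
  have A := (((A0.add A1 (c₀.of_le h4) (c₁.of_le h4)).add Ar
    ((c₀.add c₁).of_le h4) (cr.of_le h4)).congr (φ' := u) fun t ht => by
      simp only [hsum t ht]; ring)
  have hu2 : MemH 2 u := by
    have : ContDiffOn ℝ (p + 3 : ℕ) u (Icc 0 1) :=
      ((c₀.add cr).add c₁).congr hsum
    have h := (derivChain_of_contDiffOn this).memH_two (by omega)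
    rwa [D_zero] at h
  set Λ := (Real.log N / N) ^ (p + 1) with hΛ
  have hΛ0 : 0 < Λ := by positivity
  have hl := A0.memH_error.add A1.memH_error
  have key := fem_error_le hε hε1 hlam hα0 hα2 (rpow_three_halves hε) (rpow_five_halves hε) hf hu
    hu2 hfem A Ar.memH_error hl.1 Ar.clamped
    (Clamped.add A0.memH_error A1.memH_error A0.clamped A1.clamped)
    (X₁ := 2 * (K * M * Λ * Real.sqrt ε * (ε ^ 2)⁻¹))
    (X₂ := 2 * (K * (α / ε ^ 2 * M) * Λ * Real.sqrt ε * (ε ^ 2)⁻¹))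
    (by positivity) (by positivity) r4
    (fun a ha ha2 => (abs_ip_D_two_add_le A0.memH_error A1.memH_error ha2 (l03 a ha ha2)
      (l13 a ha ha2)).trans (le_of_eq (by ring)))
    (fun a ha ha2 => (abs_ip_D_two_add_le (A0.memH_error'.add A1.memH_error').1 Ar.memH_error' ha2
      (abs_ip_D_two_add_le A0.memH_error' A1.memH_error' ha2 (l04 a ha ha2) (l14 a ha ha2))
      (abs_eq_zero.2 (r5 a ha ha2)).le).trans (le_of_eq (by ring)))
  set ν := ((N : ℝ) ^ (p + 1))⁻¹ with hν
  have hν0 : 0 < ν := by positivity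
  have hΛν : Λ = Real.log N ^ (p + 1) * ν := by rw [hΛ, div_pow, hν, div_eq_mul_inv]
  have hνΛ : ν ≤ Λ := by
    rw [hΛν]
    exact le_mul_of_one_le_left hν0.le (one_le_pow₀ hL)
  have hHp : (2 / (N : ℝ)) ^ (p + 1) = 2 ^ (p + 1) * ν := by rw [div_pow, hν, div_eq_mul_inv]
  have hTν : 2 ^ (p + 1) * M ≤ T := by
    rw [hT]
    nlinarith [mul_nonneg hK.le hM]
  have hTK : 2 * (K * M) ≤ T := by
    rw [hT]
    have : 0 ≤ 2 ^ (p + 1) * M := by positivity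
    linarith
  have nr : l2norm r ≤ T * ν := by
    calc l2norm r ≤ 2 ^ (p + 1) * ν * M := by rw [← hHp]; exact r1
      _ = (2 ^ (p + 1) * M) * ν := by ring
      _ ≤ _ := by gcongr
  have nr2 : l2norm (D 2 r) ≤ T * ν * (N : ℝ) ^ 2 := by
    refine r2.trans ?_
    have e : (2 / (N : ℝ)) ^ (p + 1) = (2 / (N : ℝ)) ^ (p - 1) * (2 / (N : ℝ)) ^ 2 := by
      rw [← pow_add]
      congr 1
      omega
    -- The slack factor `4` combines with `(2/N)^{p-1}` to `(2/N)^{p+1} N²`.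
    calc (2 / (N : ℝ)) ^ (p - 1) * M ≤ 4 * ((2 / (N : ℝ)) ^ (p - 1) * M) := by
          have : 0 ≤ (2 / (N : ℝ)) ^ (p - 1) * M := by positivity
          linarith
      _ = (2 / (N : ℝ)) ^ (p + 1) * M * (N : ℝ) ^ 2 := by
          rw [e]
          field_simp
          norm_num
      _ = (2 ^ (p + 1) * M) * ν * (N : ℝ) ^ 2 := by rw [hHp]; ring
      _ ≤ _ := by gcongr
  have nl : l2norm (fun t => l0 t + l1 t) ≤ T * Λ * Real.sqrt ε := by
    refine (l2norm_add_le A0.memH_error.memLp A1.memH_error.memLp).trans ?_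
    calc _ ≤ 2 * (K * M) * Λ * Real.sqrt ε := by linarith
      _ ≤ _ := by gcongr
  have nl' : l2norm (fun t => l0 t + l1 t) ≤ T * Λ :=
    nl.trans (mul_le_of_le_one_right (by positivity) hsq1)
  have nθ : l2norm (fun t => θ0 t + θ1 t + θr t) ≤ 2 * (T * Λ) := by
    refine (l2norm_add_le (A0.memH_error'.add A1.memH_error').1.memLp
      Ar.memH_error'.memLp).trans ?_
    have e1 := l2norm_add_le A0.memH_error'.memLp A1.memH_error'.memLp
    have e2 : K * (α / ε ^ 2 * M) * Λ * Real.sqrt ε = K * M * Λ := by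
      linear_combination K * M * Λ * hαs
    rw [e2] at l02 l12
    have e3 : l2norm θr ≤ T * Λ := by
      calc l2norm θr ≤ 2 ^ (p + 1) * ν * (α * M) := by rw [← hHp]; exact r3
        _ = (2 ^ (p + 1) * M) * ν * α := by ring
        _ ≤ T * Λ * 1 := by gcongr
        _ = _ := mul_one _
    have e4 : 2 * (K * M) * Λ ≤ T * Λ := by gcongr
    linarith
  have nX1 : α * (2 * (K * M * Λ * Real.sqrt ε * (ε ^ 2)⁻¹)) ≤ T * Λ := by
    calc _ = 2 * (K * M) * Λ := by linear_combination 2 * K * M * Λ * hαs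
      _ ≤ _ := by gcongr
  have nX2 : ε ^ 2 * (2 * (K * (α / ε ^ 2 * M) * Λ * Real.sqrt ε * (ε ^ 2)⁻¹)) ≤ T * Λ := by
    have : ε ^ 2 * (ε ^ 2)⁻¹ = 1 := mul_inv_cancel₀ (by positivity)
    calc _ = 2 * (K * M) * Λ := by
          linear_combination 2 * K * M * Λ * hαs +
            2 * K * M * Λ * (α / ε ^ 2 * Real.sqrt ε) * this
      _ ≤ _ := by gcongr
  set m := min (α * (N : ℝ) ^ 2) (α / ε ^ 2) with hm
  have hm0 : 0 ≤ m := le_min (by positivity) (by positivity)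
  have nmin : min (α * l2norm (D 2 r)) (α / ε ^ 2 * l2norm r) ≤ T * (m * ν) := by
    have e : T * (m * ν) = min (α * (N : ℝ) ^ 2 * (T * ν)) (α / ε ^ 2 * (T * ν)) := by
      rw [hm, ← min_mul_of_nonneg _ _ (by positivity : 0 ≤ T * ν)]
      ring
    rw [e]
    refine min_le_min ?_ ?_
    · calc α * l2norm (D 2 r) ≤ α * (T * ν * (N : ℝ) ^ 2) := by gcongr
        _ = _ := by ring
    · gcongr
  have nαl : α / ε ^ 2 * l2norm (fun t => l0 t + l1 t) ≤ T * Λ := by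
    calc _ ≤ α / ε ^ 2 * (T * Λ * Real.sqrt ε) := by gcongr
      _ = T * Λ := by linear_combination T * Λ * hαs
  have nr' : l2norm r ≤ T * Λ := nr.trans (by gcongr)
  have n1 : (2 * lam + 4) * l2norm (fun t => θ0 t + θ1 t + θr t) ≤
      (2 * lam + 4) * (2 * (T * Λ)) := mul_le_mul_of_nonneg_left nθ (by linarith)
  have n2 := mul_le_mul_of_nonneg_left nX1 (by linarith : 0 ≤ lam)
  have n3 := mul_le_mul_of_nonneg_left (add_le_add nmin nαl) (abs_nonneg (lam - 4))
  have hTΛ : 0 ≤ T * Λ := by positivity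
  have hq : 0 ≤ |lam - 4| * (T * (m * ν)) := by positivity
  have hq' : 0 ≤ |lam - 4| * (T * Λ) := by positivity
  calc l2error ε u uh vh
      ≤ T * Λ + T * Λ + 2 * (T * Λ) + 2 * ((2 * lam + 4) * (2 * (T * Λ)) + 16 * (T * Λ + T * Λ) +
        lam * (T * Λ) + T * Λ + |lam - 4| * (T * (m * ν) + T * Λ)) := by linarith
    _ = (T * (4 + 2 * (2 * (2 * lam + 4) + 32 + lam + 1 + |lam - 4|))) * Λ +
        (2 * T) * (|lam - 4| * (m * ν)) := by ring
    _ ≤ (T * (4 + 2 * (3 * (2 * lam + 4) + 48 + lam + 1 + |lam - 4|))) * Λ +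
        (T * (4 + 2 * (3 * (2 * lam + 4) + 48 + lam + 1 + |lam - 4|))) *
          (|lam - 4| * (m * ν)) := by
        have a0 : 0 ≤ |lam - 4| := abs_nonneg _
        have a1 : 0 ≤ |lam - 4| * (m * ν) := by positivity
        refine add_le_add (mul_le_mul_of_nonneg_right
          (mul_le_mul_of_nonneg_left (by linarith) hT0.le) hΛ0.le)
          (mul_le_mul_of_nonneg_right ?_ a1)
        rw [mul_comm 2 T]
        exact mul_le_mul_of_nonneg_left (by linarith) hT0.le
    _ = _ := by rw [hΛν]; ring

end ShellFEM

theorem theorem2 (p : ℕ) (hp : 3 ≤ p) (lam : ℝ) (hlam : 3 ≤ lam) (σ : ℝ) (hσ : (p : ℝ) + 1 ≤ σ)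
    (M : ℝ) :
    ∃ C : ℝ, 0 < C ∧
      ∀ (ε : ℝ), 0 < ε → ε ≤ 1 →
      ∀ (N : ℕ), 0 < N → 4 ∣ N →
      ∀ (f u : ℝ → ℝ), MeasureTheory.MemLp f 2 ShellFEM.volΩ →
        ShellFEM.IsSolution ε f u →
        ShellFEM.HasDecomposition (p + 3) M ε f u →
      ∀ (uh vh : ℝ → ℝ), ShellFEM.IsFEMSolution p ε lam σ N f uh vh →
        ShellFEM.l2error ε u uh vh ≤
            C * (((Real.log N) ^ (p + 1)
                  + |lam - 4| * min (ε ^ (3 / 2 : ℝ) * (N : ℝ) ^ 2) (ε ^ (-(1 / 2) : ℝ)))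
              * ((N : ℝ) ^ (p + 1))⁻¹) ∧
        (lam = 4 ∨ ε ^ (3 / 2 : ℝ) ≤ ((N : ℝ) ^ 2)⁻¹ →
          ShellFEM.l2error ε u uh vh ≤ C * ((N : ℝ)⁻¹ * Real.log N) ^ (p + 1)) := by
  obtain ⟨C, hC, h⟩ := ShellFEM.exists_error_bound p hp lam hlam σ hσ M
  -- The factor makes one constant serve both estimates: in the second one the minimum is at most `1
  -- ≤ (ln N)^{p+1}`, or is multiplied by zero.
  refine ⟨C * (1 + |lam - 4|), by positivity, ?_⟩
  intro ε hε hε1 N hN hN4 f u hf hu hdec uh vh hfem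
  have hb := h ε hε hε1 N hN hN4 f u hf hu hdec uh vh hfem
  have hL := ShellFEM.one_le_log_nat (Nat.le_of_dvd hN hN4)
  have hN0 : (0 : ℝ) < N := by exact_mod_cast hN
  have hm : 0 ≤ min (ε ^ (3 / 2 : ℝ) * (N : ℝ) ^ 2) (ε ^ (-(1 / 2) : ℝ)) :=
    le_min (by positivity) (by positivity)
  refine ⟨hb.trans (mul_le_mul_of_nonneg_right (le_mul_of_one_le_right hC.le ?_) ?_),
    fun hor => hb.trans ?_⟩
  · linarith [abs_nonneg (lam - 4)]
  · positivity
  · have hLp : 1 ≤ Real.log N ^ (p + 1) := one_le_pow₀ hL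
    have hsmall : |lam - 4| * min (ε ^ (3 / 2 : ℝ) * (N : ℝ) ^ 2) (ε ^ (-(1 / 2) : ℝ)) ≤
        |lam - 4| * Real.log N ^ (p + 1) := by
      rcases hor with rfl | hε2
      · simp
      · refine mul_le_mul_of_nonneg_left ((min_le_left _ _).trans (le_trans ?_ hLp)) (abs_nonneg _)
        calc ε ^ (3 / 2 : ℝ) * (N : ℝ) ^ 2 ≤ ((N : ℝ) ^ 2)⁻¹ * (N : ℝ) ^ 2 := by gcongr
          _ = 1 := inv_mul_cancel₀ (by positivity)
    calc _ ≤ C * ((Real.log N ^ (p + 1) + |lam - 4| * Real.log N ^ (p + 1)) *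
          ((N : ℝ) ^ (p + 1))⁻¹) := by gcongr
      _ = _ := by
        rw [mul_pow, inv_pow]
        ring
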